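/- **Setting.** Let $S_0$ be a connected smooth manifold (without boundary, of any finite dimension) with a smooth Riemannian metric $\gamma$, a smooth one-form $\boldsymbol{s}$ and a smooth function $h$. On $\mathbb{R}\times\mathbb{R}\times S_0$, with points $(v,u,x)$, consider the near horizon metric $$g = 2\,dv\left(du + 2u\,\boldsymbol{s} + \tfrac12 u^2 h\,dv\right) + \gamma ,$$ restricted to an open set $M$ such that for every $x\in S_0$ there is a $v$ with $(v,0,x)\in M$; the horizon is $\mathcal{H}=M\cap\{u=0\}$. A Killing vector field $\zeta$ of $(M,g)$ is called a *degenerate Killing generator* of $\mathcal{H}$ if there is a relatively open dense subset $\mathcal{H}_\zeta$ of the null hypersurface $\mathcal{H}$ on which $\zeta$ is null, nowhere zero, tangent to $\mathcal{H}$, and has vanishing surface gravity, i.e. $\mathrm{grad}\,(g(\zeta,\zeta)) = 0$ there. Let $\mathrm{grad}$, $\Delta$, $\gamma^\sharp$ be the gradient, Laplacian and contravariant metric of $(S_0,\gamma)$. **Theorem.** Let $f$ be a smooth non-constant function on $S_0$, and set $N:=\gamma^\sharp(df,df)$. The vector field $$\zeta = f\,\partial_v + \tfrac{u^2}{2}\,\Delta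 f\,\partial_u - u\,\mathrm{grad} f$$ is a degenerate Killing generator of $\mathcal{H}$ if and only if there are smooth functions $Q,P$ of one variable, defined on the range of $f$, such that the following two conditions hold. 1. The differential $df$ vanishes nowhere; $Q$ is not identically zero and $(Q,P)$ solves, on the range of $f$, $$Q' = QP,\qquad (P'+P^2)' + P\,(P'+P^2) = 0 ;$$ and the vector field $\varsigma$ on $S_0$ metrically related to the one-form $$\boldsymbol{\varsigma} = \frac{Q(f)}{N}\,df$$ is a hypersurface-orthogonal Killing vector field of $(S_0,\gamma)$ (that is, $\boldsymbol\varsigma\wedge d\boldsymbol\varsigma=0$ and $\pounds_\varsigma\gamma=0$). 2. The one-form $\boldsymbol{s}$ and the function $h$ are $$\boldsymbol{s} = \tfrac12\left(\frac{dN}{N} - P(f)\,df\right),\qquad h = \tfrac12\,N\left(P'(f)+P(f)^2\right).$$ In particular, if $\zeta$ is a degenerate Killing generator of $\mathcal{H}$, then $\boldsymbol{s}$ is closed. Moreover, for every smooth $F:S_0\to\mathbb{R}$, the first fundamental form induced by $g$ on the cut $\{u=0,\ v=F(x)\}$ is $\gamma$, so that condition 1 does not depend on the cut. -/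

import Mathlib

open Bundle Set
open scoped Manifold ContDiff Topology

noncomputable section

namespace NHG

/-! ### Tensor calculus on a manifold without boundary

A (pseudo-Riemannian) metric is a field of bilinear forms on the tangent spaces. Derivatives are
written in the preferred chart `extChartAt I p` at the point `p`; the resulting expressions are
the components at `p` of objects that do not depend on the chart. -/

section General

variable {E : Type*} [NormedAddCommGroup E] [NormedSpace ℝ E]
  {H : Type*} [TopologicalSpace H] (I : ModelWithCorners ℝ E H)
  {M : Type*} [TopologicalSpace M] [ChartedSpace H M]

/-- The tangent vector at the point with coordinates `y` (in the chart at `p`) that has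
components `v`, i.e. `v^μ ∂_μ`. -/
def ofComponents (p : M) (y : E) (v : E) : TangentSpace I ((extChartAt I p).symm y) :=
  mfderiv 𝓘(ℝ, E) I (extChartAt I p).symm y v

/-- The components, in the chart at `p`, of a tangent vector `X` at `q`. -/
def components (p q : M) (X : TangentSpace I q) : E :=
  mfderiv I 𝓘(ℝ, E) (extChartAt I p) q X

/-- The components `g_{μν}(y)` of `g` in the chart at `p`, as the form `g_{μν}(y) v^μ w^ν`. -/
def localMetric (g : Π q : M, TangentSpace I q → TangentSpace I q → ℝ) (p : M) (y v w : E) : ℝ :=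
  g ((extChartAt I p).symm y) (ofComponents I p y v) (ofComponents I p y w)

/-- The components `ζ^μ(y)` of a vector field in the chart at `p`. -/
def localField (ζ : Π q : M, TangentSpace I q) (p : M) (y : E) : E :=
  components I p ((extChartAt I p).symm y) (ζ ((extChartAt I p).symm y))

/-- The components `α_μ(y)` of a one-form in the chart at `p`, as the form `α_μ(y) v^μ`. -/
def localOneForm (α : Π q : M, TangentSpace I q →L[ℝ] ℝ) (p : M) (y v : E) : ℝ :=
  α ((extChartAt I p).symm y) (ofComponents I p y v)

/-- The Lie derivative of a metric at `p`,
`(£_ζ g)_{μν} = ζ^ρ ∂_ρ g_{μν} + g_{ρν} ∂_μ ζ^ρ + g_{μρ} ∂_ν ζ^ρ`,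
contracted with the component vectors `v`, `w`. -/
def lieDerivMetric (g : Π q : M, TangentSpace I q → TangentSpace I q → ℝ)
    (ζ : Π q : M, TangentSpace I q) (p : M) (v w : E) : ℝ :=
  fderiv ℝ (fun y => localMetric I g p y v w) (extChartAt I p p) (localField I ζ p (extChartAt I p p))
    + localMetric I g p (extChartAt I p p) (fderiv ℝ (localField I ζ p) (extChartAt I p p) v) w
    + localMetric I g p (extChartAt I p p) v (fderiv ℝ (localField I ζ p) (extChartAt I p p) w)

/-- `ζ` is a Killing vector field of the metric `g` on the open set `U`. -/
def IsKillingOn [IsManifold I ∞ M] (g : Π q : M, TangentSpace I q → TangentSpace I q → ℝ)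
    (U : Set M) (ζ : Π q : M, TangentSpace I q) : Prop :=
  ContMDiffOn I I.tangent ∞ (fun q => (⟨q, ζ q⟩ : TangentBundle I M)) U ∧
    ∀ p ∈ U, ∀ v w : E, lieDerivMetric I g ζ p v w = 0

/-- The exterior derivative of a one-form at `p`, `(dα)_{μν} = ∂_μ α_ν - ∂_ν α_μ`, contracted
with the component vectors `v`, `w`. -/
def extDerivOneForm (α : Π q : M, TangentSpace I q →L[ℝ] ℝ) (p : M) (v w : E) : ℝ :=
  fderiv ℝ (fun y => localOneForm I α p y w) (extChartAt I p p) v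
    - fderiv ℝ (fun y => localOneForm I α p y v) (extChartAt I p p) w

/-- The one-form `α` is closed, `dα = 0`. -/
def IsClosedOneForm (α : Π q : M, TangentSpace I q →L[ℝ] ℝ) : Prop :=
  ∀ (p : M) (v w : E), extDerivOneForm I α p v w = 0

/-- `α ∧ dα = 0`: the vector field metrically related to `α` is hypersurface orthogonal. -/
def IsHypersurfaceOrthogonal (α : Π q : M, TangentSpace I q →L[ℝ] ℝ) : Prop :=
  ∀ (p : M) (u v w : E),
    localOneForm I α p (extChartAt I p p) u * extDerivOneForm I α p v w
      + localOneForm I α p (extChartAt I p p) v * extDerivOneForm I α p w u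
      + localOneForm I α p (extChartAt I p p) w * extDerivOneForm I α p u v = 0

/-- `df` at `x`, as a linear form on the tangent space. -/
def diff (f : M → ℝ) (x : M) : TangentSpace I x →L[ℝ] ℝ :=
  mfderiv I 𝓘(ℝ, ℝ) f x

/-- `grad (g(ζ,ζ)) = -2 κ ζ` at `p`, with the index lowered: the surface gravity of `ζ` at `p`
is `κ`. -/
def HasSurfaceGravityAt (g : Π q : M, TangentSpace I q → TangentSpace I q → ℝ)
    (ζ : Π q : M, TangentSpace I q) (p : M) (κ : ℝ) : Prop :=
  ∀ X : TangentSpace I p, diff I (fun q => g q (ζ q) (ζ q)) p X = -2 * κ * g p (ζ p) X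

/-- Let `K` be (a relatively open part of) a smooth hypersurface given as a zero set of a function
`r` with nonvanishing differential. `K` is a Killing horizon of `ζ`: it is null (there is a nonzero
vector tangent to it and orthogonal to all vectors tangent to it), and `ζ` is null, nowhere zero
and tangent to `K`, on `K`. -/
def IsKillingHorizon (g : Π q : M, TangentSpace I q → TangentSpace I q → ℝ) (r : M → ℝ)
    (K : Set M) (ζ : Π q : M, TangentSpace I q) : Prop :=
  ∀ p ∈ K,
    (∃ k : TangentSpace I p, k ≠ 0 ∧ diff I r p k = 0 ∧
      ∀ X : TangentSpace I p, diff I r p X = 0 → g p k X = 0) ∧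
    ζ p ≠ 0 ∧ g p (ζ p) (ζ p) = 0 ∧ diff I r p (ζ p) = 0

/-- `ζ` is a degenerate Killing generator of the hypersurface `{r = 0}` in the spacetime `(U, g)`,
`U` open: `ζ` is a Killing vector of `(U, g)`, and there is a Killing horizon of `ζ`
with vanishing surface gravity that is an open part `V ∩ {r = 0}` of the hypersurface and has the
same closure as it. (`ζ` may thus have zeros on the hypersurface, but only on a nowhere dense
subset.) -/
def IsDegenerateKillingGenerator [IsManifold I ∞ M]
    (g : Π q : M, TangentSpace I q → TangentSpace I q → ℝ)
    (U : Set M) (r : M → ℝ) (ζ : Π q : M, TangentSpace I q) : Prop :=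
  IsKillingOn I g U ζ ∧
    ∃ V : Set M, IsOpen V ∧ V ⊆ U ∧ U ∩ {p | r p = 0} ⊆ closure (V ∩ {p | r p = 0}) ∧
      IsKillingHorizon I g r (V ∩ {p | r p = 0}) ζ ∧
      ∀ p ∈ V ∩ {p | r p = 0}, HasSurfaceGravityAt I g ζ p 0

end General

/-! ### Riemannian notions on the cut -/

section Riemannian

variable {d : ℕ} {S : Type*} [TopologicalSpace S] [ChartedSpace (EuclideanSpace ℝ (Fin d)) S]
  [IsManifold (𝓡 d) ∞ S]

/-- Smooth Riemannian metrics on `S`. -/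
abbrev RiemMetric (d : ℕ) (S : Type*) [TopologicalSpace S]
    [ChartedSpace (EuclideanSpace ℝ (Fin d)) S] [IsManifold (𝓡 d) ∞ S] :=
  ContMDiffRiemannianMetric (𝓡 d) ∞ (EuclideanSpace ℝ (Fin d))
    (fun x : S => TangentSpace (𝓡 d) x)

/-- A Riemannian metric as a field of bilinear forms. -/
def RiemMetric.form (γ : RiemMetric d S) (x : S) (X Y : TangentSpace (𝓡 d) x) : ℝ :=
  γ.inner x X Y

theorem exists_sharp (γ : RiemMetric d S) (x : S) (α : TangentSpace (𝓡 d) x →L[ℝ] ℝ) :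
    ∃ X : TangentSpace (𝓡 d) x, ∀ Y, γ.form x X Y = α Y := by
  have : FiniteDimensional ℝ (TangentSpace (𝓡 d) x) :=
    inferInstanceAs (FiniteDimensional ℝ (EuclideanSpace ℝ (Fin d)))
  let L : TangentSpace (𝓡 d) x →ₗ[ℝ] Module.Dual ℝ (TangentSpace (𝓡 d) x) :=
    { toFun := fun X => (γ.inner x X : TangentSpace (𝓡 d) x →ₗ[ℝ] ℝ)
      map_add' := fun a b => by ext; simp
      map_smul' := fun a b => by ext; simp }
  have hinj : Function.Injective L := by
    rw [← LinearMap.ker_eq_bot, LinearMap.ker_eq_bot']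
    intro m hm
    by_contra hne
    have h1 := γ.pos x m hne
    have h2 : L m m = 0 := by rw [hm]; rfl
    exact h1.ne' h2
  have hsurj : Function.Surjective L :=
    (LinearMap.injective_iff_surjective_of_finrank_eq_finrank
      (Subspace.dual_finrank_eq (K := ℝ) (V := TangentSpace (𝓡 d) x)).symm).1 hinj
  obtain ⟨X, hX⟩ := hsurj (α : TangentSpace (𝓡 d) x →ₗ[ℝ] ℝ)
  exact ⟨X, fun Y => congrArg (fun l : Module.Dual ℝ (TangentSpace (𝓡 d) x) => l Y) hX⟩

/-- Raising an index: the vector metrically related to the covector `α`. -/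
def sharp (γ : RiemMetric d S) (x : S) (α : TangentSpace (𝓡 d) x →L[ℝ] ℝ) :
    TangentSpace (𝓡 d) x :=
  (exists_sharp γ x α).choose

theorem form_sharp (γ : RiemMetric d S) (x : S) (α : TangentSpace (𝓡 d) x →L[ℝ] ℝ)
    (Y : TangentSpace (𝓡 d) x) : γ.form x (sharp γ x α) Y = α Y :=
  (exists_sharp γ x α).choose_spec Y

/-- The gradient of a function. -/
def grad (γ : RiemMetric d S) (f : S → ℝ) (x : S) : TangentSpace (𝓡 d) x :=
  sharp γ x (diff (𝓡 d) f x)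

/-- `N = γ^♯(df, df)`. -/
def normSq (γ : RiemMetric d S) (f : S → ℝ) (x : S) : ℝ :=
  γ.form x (grad γ f x) (grad γ f x)

/-- The Hessian `D_A D_B f = ∂_A ∂_B f - Γ^C_{AB} ∂_C f` at `x` for the Levi-Civita connection,
contracted with the component vectors `v`, `w`; here
`Γ^C_{AB} ∂_C f = ½ (∂_A γ_{BC} + ∂_B γ_{AC} - ∂_C γ_{AB}) D^C f`. -/
def hessian (γ : RiemMetric d S) (f : S → ℝ) (x : S) (v w : EuclideanSpace ℝ (Fin d)) : ℝ :=
  let y₀ := extChartAt (𝓡 d) x x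
  let G := components (𝓡 d) x x (grad γ f x)
  let dγ := fun a b c : EuclideanSpace ℝ (Fin d) =>
    fderiv ℝ (fun y => localMetric (𝓡 d) γ.form x y b c) y₀ a
  fderiv ℝ (fun y => fderiv ℝ (fun z => f ((extChartAt (𝓡 d) x).symm z)) y w) y₀ v
    - (1 / 2) * (dγ v w G + dγ w v G - dγ G v w)

/-- The coordinate one-form `dx^A` at `x`, of the chart at `x`. -/
def coordForm (x : S) (i : Fin d) : TangentSpace (𝓡 d) x →L[ℝ] ℝ :=
  (EuclideanSpace.proj i : EuclideanSpace ℝ (Fin d) →L[ℝ] ℝ).comp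
    (mfderiv (𝓡 d) 𝓘(ℝ, EuclideanSpace ℝ (Fin d)) (extChartAt (𝓡 d) x) x)

/-- The Laplacian `Δf = γ^{AB} D_A D_B f`; the vector `sharp γ x (coordForm x i)` has the
components `γ^{iB}`. -/
def laplacian (γ : RiemMetric d S) (f : S → ℝ) (x : S) : ℝ :=
  ∑ i : Fin d, hessian γ f x (EuclideanSpace.single i 1)
    (components (𝓡 d) x x (sharp γ x (coordForm x i)))

end Riemannian

/-! ### Near horizon geometries -/

section NearHorizon

/-- The data of a near horizon geometry on the `d`-dimensional manifold `S`: a Riemannian metric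
`γ`, a one-form `s` and a function `h`, all smooth. -/
structure Data (d : ℕ) (S : Type*) [TopologicalSpace S]
    [ChartedSpace (EuclideanSpace ℝ (Fin d)) S] [IsManifold (𝓡 d) ∞ S] where
  γ : RiemMetric d S
  s : Π x : S, TangentSpace (𝓡 d) x →L[ℝ] ℝ
  h : S → ℝ
  smooth_s : ContMDiff (𝓡 d) ((𝓡 d).prod 𝓘(ℝ, EuclideanSpace ℝ (Fin d) →L[ℝ] ℝ)) ∞
    (fun x => TotalSpace.mk' (EuclideanSpace ℝ (Fin d) →L[ℝ] ℝ)
      (E := fun x : S => TangentSpace (𝓡 d) x →L[ℝ] Bundle.Trivial S ℝ x) x (s x))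
  smooth_h : ContMDiff (𝓡 d) 𝓘(ℝ, ℝ) ∞ h

/-- The model of the manifold `ℝ × ℝ × S`, with points `(v, u, x)`. -/
abbrev model (d : ℕ) := 𝓘(ℝ, ℝ).prod (𝓘(ℝ, ℝ).prod (𝓡 d))

variable {d : ℕ} {S : Type*} [TopologicalSpace S] [ChartedSpace (EuclideanSpace ℝ (Fin d)) S]

/-- The tangent vector `a ∂_v + b ∂_u + Z` at `p = (v, u, x)`, where `Z` is tangent to `S`. -/
def mkTangent (p : ℝ × ℝ × S) (a b : ℝ) (Z : TangentSpace (𝓡 d) p.2.2) :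
    TangentSpace (model d) p :=
  ((a, b, Z) : ℝ × ℝ × EuclideanSpace ℝ (Fin d))

/-- The `∂_v` component. -/
def vPart {p : ℝ × ℝ × S} (X : TangentSpace (model d) p) : ℝ :=
  Prod.fst (X : ℝ × ℝ × EuclideanSpace ℝ (Fin d))

/-- The `∂_u` component. -/
def uPart {p : ℝ × ℝ × S} (X : TangentSpace (model d) p) : ℝ :=
  Prod.fst (Prod.snd (X : ℝ × ℝ × EuclideanSpace ℝ (Fin d)))

/-- The component tangent to `S`. -/
def sPart {p : ℝ × ℝ × S} (X : TangentSpace (model d) p) : TangentSpace (𝓡 d) p.2.2 :=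
  Prod.snd (Prod.snd (X : ℝ × ℝ × EuclideanSpace ℝ (Fin d)))

variable [IsManifold (𝓡 d) ∞ S]

/-- The one-form `du + 2 u s + ½ u² h dv`. -/
def Data.conormal (D : Data d S) (p : ℝ × ℝ × S) (X : TangentSpace (model d) p) : ℝ :=
  uPart X + 2 * p.2.1 * D.s p.2.2 (sPart X) + (1 / 2) * p.2.1 ^ 2 * D.h p.2.2 * vPart X

/-- The near horizon metric `2 dv (du + 2 u s + ½ u² h dv) + γ` on `ℝ × ℝ × S`
(`2 α β` stands for `α ⊗ β + β ⊗ α`). -/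
def Data.metric (D : Data d S) (p : ℝ × ℝ × S) (X Y : TangentSpace (model d) p) : ℝ :=
  vPart X * D.conormal p Y + vPart Y * D.conormal p X + D.γ.form p.2.2 (sPart X) (sPart Y)

/-- The function `u` on `ℝ × ℝ × S`; the horizon is `{u = 0}`. -/
def uCoord (p : ℝ × ℝ × S) : ℝ := p.2.1

/-- The vector field `f ∂_v + (u²/2) Δf ∂_u - u grad f`. -/
def Data.zeta (D : Data d S) (f : S → ℝ) (p : ℝ × ℝ × S) : TangentSpace (model d) p :=
  mkTangent p (f p.2.2) (p.2.1 ^ 2 / 2 * laplacian D.γ f p.2.2)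
    (-p.2.1 • grad D.γ f p.2.2)

/-- The embedding `x ↦ (F x, 0, x)` of the cut `{u = 0, v = F(x)}` of the horizon. -/
def cutMap (F : S → ℝ) (x : S) : ℝ × ℝ × S := (F x, 0, x)

/-- The first fundamental form of the cut `{u = 0, v = F(x)}`. -/
def Data.cutMetric (D : Data d S) (F : S → ℝ) (x : S) (X Y : TangentSpace (𝓡 d) x) : ℝ :=
  D.metric (cutMap F x) (mfderiv (𝓡 d) (model d) (cutMap F) x X)
    (mfderiv (𝓡 d) (model d) (cutMap F) x Y)

/-- The system `Q' = Q P`, `(P' + P²)' + P (P' + P²) = 0` on the set `J`, for smooth `Q`, `P`. -/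
def SolvesODE (Q P : ℝ → ℝ) (J : Set ℝ) : Prop :=
  ContDiffOn ℝ ∞ Q J ∧ ContDiffOn ℝ ∞ P J ∧
    (∀ t ∈ J, deriv Q t = Q t * P t) ∧
    ∀ t ∈ J, deriv (fun τ => deriv P τ + P τ ^ 2) t + P t * (deriv P t + P t ^ 2) = 0

/-- The one-form `(Q(f)/N) df`. -/
def Data.varsigma (D : Data d S) (Q : ℝ → ℝ) (f : S → ℝ) (x : S) :
    TangentSpace (𝓡 d) x →L[ℝ] ℝ :=
  (Q (f x) / normSq D.γ f x) • diff (𝓡 d) f x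

/-- The first condition: `df` vanishes nowhere, `Q` is not identically zero and solves the
ODE system together with `P` on the range of `f`, and `(Q(f)/N) df` is metrically related to a
hypersurface-orthogonal Killing vector field of `(S, γ)`. -/
def Data.CondKilling (D : Data d S) (f : S → ℝ) (Q P : ℝ → ℝ) : Prop :=
  (∀ x, diff (𝓡 d) f x ≠ 0) ∧
    SolvesODE Q P (range f) ∧ (∃ t ∈ range f, Q t ≠ 0) ∧
    IsKillingOn (𝓡 d) D.γ.form univ (fun x => sharp D.γ x (D.varsigma Q f x)) ∧
    IsHypersurfaceOrthogonal (𝓡 d) (D.varsigma Q f)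

/-- The second condition: `s = ½ (dN/N - P(f) df)` and `h = ½ N (P' + P²)(f)`. -/
def Data.CondTorsion (D : Data d S) (f : S → ℝ) (P : ℝ → ℝ) : Prop :=
  (∀ x, D.s x = (1 / 2 : ℝ) • ((normSq D.γ f x)⁻¹ • diff (𝓡 d) (normSq D.γ f) x
      - P (f x) • diff (𝓡 d) f x)) ∧
    ∀ x, D.h x = 1 / 2 * normSq D.γ f x * (deriv P (f x) + P (f x) ^ 2)

end NearHorizon

end NHG

end

noncomputable section

namespace NHG

/-! ### Tensor components in the preferred chart -/

section Charts

variable {E : Type*} [NormedAddCommGroup E] [NormedSpace ℝ E]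
  {H : Type*} [TopologicalSpace H] (I : ModelWithCorners ℝ E H)
  {M : Type*} [TopologicalSpace M] [ChartedSpace H M]

section

variable [I.Boundaryless]

/-! In coordinates the Lie derivative of the near horizon metric along `ζ` is a polynomial in `u`
without constant term (`lie_nearHorizonForm`, `Data.lieDerivMetric_zeta`). It vanishes on the
horizon, but since `U` is open there is a point with `u ≠ 0` over every `x`, and there the
coefficients can be separated. Hence `ζ` is Killing iff three equations hold on the cut: `Hess f =
df ⊗ s + s ⊗ df`, a one-form equation from the `dv dx` components, and `dh(grad f) = Δf h`
(`Data.isKillingOn_zeta_iff`). The `dv du` component is the trace of the Hessian equation.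

The Hessian equation gives `dN = Δf df + 2 N s` with `Δf = 2 s(grad f)`, so `|dN| ≤ K N` locally. By
Grönwall the zero set of `N` is open and closed, and for non-constant `f` on a connected manifold
`df` has no zeros (`Data.diff_ne_zero_of_hessianEq`). Dividing by `N` yields `s = ½ (dN/N - p df)`
with `p = Δf/N`. With `r = 2h/N`, the other two equations become `dp = (r - p²) df` and `dr = -p r
df`.

It remains to write `p` and `r` as functions of `f`, although level sets of `f` may be disconnected.
Formally `p = Q'/Q` and `r = Q''/Q` with `Q''' = 0`. So `Q` is taken to be the quadratic polynomial
matching `1, p, r` at one point; the errors `Q'(f) - p Q(f)` and `Q''- r Q(f)` solve a homogeneous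
linear system along `f`, and vanish everywhere by unique continuation (`Data.exists_potentials`).
Then `P = Q'/Q`.

For `k = Q(f)/N` the relation `Q' = QP` says `dk = -2 k s`, so the Lie derivative of `γ` along `k
grad f` is `2k (Hess f - df ⊗ s - s ⊗ df)`: where `Q(f) ≠ 0`, the Killing equation for `ς` is the
Hessian equation (`Data.lieDerivMetric_sharp_varsigma`). This gives both directions; the converse is
`Data.killing_equations_of_potentials`.

The remaining horizon conditions follow from the form of `ζ`: it equals `f ∂_v` at `u = 0`, the set
`f ≠ 0` is dense because `df ≠ 0`, and `g(ζ,ζ)` has a factor `u²`. Finally `ds = -½ dp ∧ df`, which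
vanishes for `p = P(f)`. -/

theorem contMDiffAt_iff_contDiffAt_comp_symm {V : Type*} [NormedAddCommGroup V] [NormedSpace ℝ V]
    {f : M → V} {p : M} :
    ContMDiffAt I 𝓘(ℝ, V) ∞ f p ↔
      ContDiffAt ℝ ∞ (fun y => f ((extChartAt I p).symm y)) (extChartAt I p p) := by
  rw [contMDiffAt_iff, I.range_eq_univ, contDiffWithinAt_univ]
  constructor
  · exact fun h => h.2
  · intro h
    refine ⟨?_, h⟩
    have h1 : ContinuousAt (fun q => f ((extChartAt I p).symm (extChartAt I p q))) p :=
      ContinuousAt.comp (f := extChartAt I p) (g := fun y => f ((extChartAt I p).symm y))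
        h.continuousAt (continuousAt_extChartAt p)
    refine h1.congr ?_
    filter_upwards [extChartAt_source_mem_nhds (I := I) p] with q hq
    rw [(extChartAt I p).left_inv hq]

theorem _root_.ContMDiffAt.contDiffAt_comp_symm {V : Type*} [NormedAddCommGroup V]
    [NormedSpace ℝ V] {f : M → V} {p : M} (h : ContMDiffAt I 𝓘(ℝ, V) ∞ f p) :
    ContDiffAt ℝ ∞ (fun y => f ((extChartAt I p).symm y)) (extChartAt I p p) :=
  (contMDiffAt_iff_contDiffAt_comp_symm I).1 h

end

variable [IsManifold I ∞ M]

theorem components_self (p : M) (X : TangentSpace I p) : components I p p X = X := by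
  have h := mfderiv_extChartAt_self (I := I) (x := p)
  exact congrArg (fun l : E →L[ℝ] E => l X) h

theorem localField_self (ζ : Π q : M, TangentSpace I q) (p : M) :
    localField I ζ p (extChartAt I p p) = ζ p := by
  -- The point `(extChartAt I p).symm (extChartAt I p p)` equals `p` only propositionally, so the
  -- base point is generalized before the dependent types are identified.
  have key : ∀ (q : M) (_ : q = p), components I p q (ζ q) = ζ p := by
    rintro q rfl; exact components_self I _ _
  exact key _ (extChartAt_to_inv p)

theorem trivializationAt_snd_eq_components {p q : M} (hq : q ∈ (chartAt H p).source)
    (X : TangentSpace I q) :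
    (trivializationAt E (TangentSpace I) p ⟨q, X⟩).2 = components I p q X := by
  have h := TangentBundle.continuousLinearMapAt_trivializationAt (I := I) hq
  have h' := congrArg (fun l : E →L[ℝ] E => l X) h
  refine Eq.trans ?_ h'
  exact ((trivializationAt E (TangentSpace I) p).continuousLinearMapAt_apply_of_mem ℝ
    (by simpa using hq) X).symm

/-- The coordinate frame fields are smooth; inserting them into smooth tensor fields shows that the
components of the latter are smooth. -/
theorem contMDiffOn_symmL (p : M) (v : E) :
    ContMDiffOn I I.tangent ∞ (fun q => (⟨q, (trivializationAt E (TangentSpace I) p).symmL ℝ q v⟩ :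
      TangentBundle I M)) (chartAt H p).source := by
  refine ((trivializationAt E (TangentSpace I) p).contMDiffOn_section_iff (IB := I) (n := ∞)
    (chartAt H p).open_source (by simp)).2 ?_
  refine (contMDiffOn_const (c := v)).congr fun q hq => ?_
  have := (trivializationAt E (TangentSpace I) p).continuousLinearMapAt_symmL (R := ℝ)
    (b := q) (by simpa using hq) v
  rwa [(trivializationAt E (TangentSpace I) p).continuousLinearMapAt_apply_of_mem ℝ
    (by simpa using hq)] at this

theorem contDiffOn_comp_symm {V : Type*} [NormedAddCommGroup V] [NormedSpace ℝ V] {f : M → V}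
    {p : M} (hf : ContMDiffOn I 𝓘(ℝ, V) ∞ f (chartAt H p).source) :
    ContDiffOn ℝ ∞ (fun y => f ((extChartAt I p).symm y)) (extChartAt I p).target := by
  rw [← contMDiffOn_iff_contDiffOn]
  refine hf.comp (contMDiffOn_extChartAt_symm p) fun y hy => ?_
  rw [mem_preimage, ← extChartAt_source (I := I)]
  exact (extChartAt I p).map_target hy

variable [I.Boundaryless]

theorem components_ofComponents {p : M} {y : E} (hy : y ∈ (extChartAt I p).target) (v : E) :
    components I p ((extChartAt I p).symm y) (ofComponents I p y v) = v := by
  have h := mfderiv_extChartAt_comp_mfderivWithin_extChartAt_symm (I := I) hy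
  rw [I.range_eq_univ, mfderivWithin_univ] at h
  exact congrArg (fun l : E →L[ℝ] E => l v) h

theorem ofComponents_components {p : M} {y : E} (hy : y ∈ (extChartAt I p).target)
    (X : TangentSpace I ((extChartAt I p).symm y)) :
    ofComponents I p y (components I p ((extChartAt I p).symm y) X) = X := by
  have h := mfderivWithin_extChartAt_symm_comp_mfderiv_extChartAt (I := I) hy
  rw [I.range_eq_univ, mfderivWithin_univ] at h
  exact congrArg (fun l : E →L[ℝ] E => l X) h

theorem ofComponents_self (p : M) (v : E) :
    (ofComponents I p (extChartAt I p p) v : E) = v := by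
  have h := mfderivWithin_range_extChartAt_symm (I := I) (x := p)
  rw [I.range_eq_univ, mfderivWithin_univ] at h
  exact congrArg (fun l : E →L[ℝ] E => l v) h

theorem localMetric_self (g : Π q : M, TangentSpace I q → TangentSpace I q → ℝ) (p : M) (v w : E) :
    localMetric I g p (extChartAt I p p) v w = g p v w := by
  have key : ∀ (q : M) (_ : q = p) (a b : E) (_ : a = v) (_ : b = w),
      g q (show TangentSpace I q from a) (show TangentSpace I q from b) = g p v w := by
    rintro q rfl a b rfl rfl; rfl
  exact key _ (extChartAt_to_inv p) _ _ (ofComponents_self I p v) (ofComponents_self I p w)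

theorem localOneForm_self (α : Π q : M, TangentSpace I q →L[ℝ] ℝ) (p : M) (v : E) :
    localOneForm I α p (extChartAt I p p) v = α p v := by
  have key : ∀ (q : M) (_ : q = p) (a : E) (_ : a = v),
      α q (show TangentSpace I q from a) = α p v := by
    rintro q rfl a rfl; rfl
  exact key _ (extChartAt_to_inv p) _ (ofComponents_self I p v)

theorem ofComponents_localField {p : M} {y : E} (hy : y ∈ (extChartAt I p).target)
    (ζ : Π q : M, TangentSpace I q) :
    ofComponents I p y (localField I ζ p y) = ζ ((extChartAt I p).symm y) :=
  ofComponents_components I hy _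

theorem mdifferentiableAt_extChartAt_symm {p : M} {y : E} (hy : y ∈ (extChartAt I p).target) :
    MDifferentiableAt 𝓘(ℝ, E) I (extChartAt I p).symm y := by
  have := mdifferentiableWithinAt_extChartAt_symm (I := I) hy
  rwa [I.range_eq_univ, mdifferentiableWithinAt_univ] at this

theorem fderiv_comp_symm {f : M → ℝ} {p : M} {y : E} (hy : y ∈ (extChartAt I p).target)
    (hf : MDifferentiableAt I 𝓘(ℝ, ℝ) f ((extChartAt I p).symm y)) (v : E) :
    fderiv ℝ (fun z => f ((extChartAt I p).symm z)) y v
      = diff I f ((extChartAt I p).symm y) (ofComponents I p y v) := by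
  rw [← mfderiv_eq_fderiv]
  have h := mfderiv_comp y (g := f) (f := (extChartAt I p).symm) hf
    (mdifferentiableAt_extChartAt_symm I hy)
  exact congrArg (fun l : E →L[ℝ] ℝ => l v) h

theorem diff_apply_eq_fderiv {f : M → ℝ} {p : M} (hf : MDifferentiableAt I 𝓘(ℝ, ℝ) f p) (v : E) :
    diff I f p v = fderiv ℝ (fun z => f ((extChartAt I p).symm z)) (extChartAt I p p) v :=
  ((fderiv_comp_symm I (mem_extChartAt_target p) (by rwa [extChartAt_to_inv]) v).trans
    (localOneForm_self I (diff I f) p v)).symm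

theorem contMDiffAt_iff_contDiffAt_localField {ζ : Π q : M, TangentSpace I q} {p : M} :
    ContMDiffAt I I.tangent ∞ (fun q => (⟨q, ζ q⟩ : TangentBundle I M)) p ↔
      ContDiffAt ℝ ∞ (localField I ζ p) (extChartAt I p p) := by
  have h1 := Bundle.contMDiffAt_section (IB := I) (F := E) (n := ∞) (E := TangentSpace I)
    (s := ζ) p
  refine Iff.trans h1 ?_
  have h2 : (fun q => (trivializationAt E (TangentSpace I) p ⟨q, ζ q⟩).2)
      =ᶠ[𝓝 p] fun q => components I p q (ζ q) := by
    filter_upwards [(chartAt H p).open_source.mem_nhds (mem_chart_source H p)] with q hq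
    exact trivializationAt_snd_eq_components I hq _
  rw [h2.contMDiffAt_iff]
  exact contMDiffAt_iff_contDiffAt_comp_symm I

/-- Links the trivialization of the tangent bundle, in which smoothness of sections is expressed,
with the derivative of the inverse chart, in which components are expressed. -/
theorem symmL_eq_ofComponents {p : M} {y : E} (hy : y ∈ (extChartAt I p).target) (v : E) :
    (trivializationAt E (TangentSpace I) p).symmL ℝ ((extChartAt I p).symm y) v
      = ofComponents I p y v := by
  have hq : (extChartAt I p).symm y ∈ (chartAt H p).source := by
    rw [← extChartAt_source (I := I)]; exact (extChartAt I p).map_target hy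
  rw [← ofComponents_components I hy ((trivializationAt E (TangentSpace I) p).symmL ℝ
    ((extChartAt I p).symm y) v)]
  congr 1
  have h := TangentBundle.continuousLinearMapAt_trivializationAt (I := I) hq
  have h' := congrArg (fun l : E →L[ℝ] E => l
    ((trivializationAt E (TangentSpace I) p).symmL ℝ ((extChartAt I p).symm y) v)) h
  refine h'.symm.trans ?_
  exact (trivializationAt E (TangentSpace I) p).continuousLinearMapAt_symmL (R := ℝ)
    (by simpa using hq) v

theorem contDiffOn_localOneForm {α : Π q : M, TangentSpace I q →L[ℝ] ℝ}
    (hα : ContMDiff I (I.prod 𝓘(ℝ, E →L[ℝ] ℝ)) ∞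
      (fun x => TotalSpace.mk' (E →L[ℝ] ℝ)
        (E := fun x : M => TangentSpace I x →L[ℝ] Bundle.Trivial M ℝ x) x (α x)))
    (p : M) (v : E) :
    ContDiffOn ℝ ∞ (fun y => localOneForm I α p y v) (extChartAt I p).target := by
  have h1 := (hα.contMDiffOn (s := (chartAt H p).source)).clm_bundle_apply
    (contMDiffOn_symmL I p v)
  have h2 : ContMDiffOn I 𝓘(ℝ, ℝ) ∞
      (fun q => α q ((trivializationAt E (TangentSpace I) p).symmL ℝ q v))
      (chartAt H p).source := fun q hq =>
    (Bundle.contMDiffWithinAt_totalSpace.1 (h1 q hq)).2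
  refine (contDiffOn_comp_symm I h2).congr fun y hy => ?_
  rw [symmL_eq_ofComponents I hy]; rfl

theorem contDiffOn_localMetric {g : Π q : M, TangentSpace I q →L[ℝ] TangentSpace I q →L[ℝ] ℝ}
    (hg : ContMDiff I (I.prod 𝓘(ℝ, E →L[ℝ] E →L[ℝ] ℝ)) ∞
      (fun x => TotalSpace.mk' (E →L[ℝ] E →L[ℝ] ℝ)
        (E := fun x : M => TangentSpace I x →L[ℝ] TangentSpace I x →L[ℝ] Bundle.Trivial M ℝ x)
        x (g x)))
    (p : M) (v w : E) :
    ContDiffOn ℝ ∞ (fun y => localMetric I (fun q X Y => g q X Y) p y v w)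
      (extChartAt I p).target := by
  have h1 := (hg.contMDiffOn (s := (chartAt H p).source)).clm_bundle_apply₂
    (contMDiffOn_symmL I p v) (contMDiffOn_symmL I p w)
  have h2 : ContMDiffOn I 𝓘(ℝ, ℝ) ∞
      (fun q => g q ((trivializationAt E (TangentSpace I) p).symmL ℝ q v)
        ((trivializationAt E (TangentSpace I) p).symmL ℝ q w))
      (chartAt H p).source := fun q hq =>
    (Bundle.contMDiffWithinAt_totalSpace.1 (h1 q hq)).2
  refine (contDiffOn_comp_symm I h2).congr fun y hy => ?_
  rw [symmL_eq_ofComponents I hy, symmL_eq_ofComponents I hy]; rfl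

end Charts

/-! ### Calculus in a vector space: Lie derivatives, Hessians, the near horizon metric -/

section LocalCalculus

variable {E : Type*} [NormedAddCommGroup E] [NormedSpace ℝ E]

theorem hasFDerivAt_bilin_apply {g : E → E →L[ℝ] E →L[ℝ] ℝ} {y : E}
    (hg : DifferentiableAt ℝ g y) (b c : E) :
    HasFDerivAt (fun z => g z b c) (((fderiv ℝ g y).flip b).flip c) y := by
  have h := (hg.hasFDerivAt.clm_apply (hasFDerivAt_const b y)).clm_apply (hasFDerivAt_const c y)
  refine h.congr_fderiv ?_
  ext a; simp

theorem fderiv_bilin_apply {g : E → E →L[ℝ] E →L[ℝ] ℝ} {y : E}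
    (hg : DifferentiableAt ℝ g y) (a b c : E) :
    fderiv ℝ (fun z => g z b c) y a = fderiv ℝ g y a b c := by
  rw [(hasFDerivAt_bilin_apply hg b c).fderiv]; rfl

theorem fderiv_form_apply {α : E → E →L[ℝ] ℝ} {y : E}
    (hα : DifferentiableAt ℝ α y) (a b : E) :
    fderiv ℝ (fun z => α z b) y a = fderiv ℝ α y a b := by
  rw [fderiv_clm_apply hα (differentiableAt_const b)]; simp

theorem fderiv_fderiv_comm {F : E → ℝ} {y : E} (hF : ContDiffAt ℝ ∞ F y) (v w : E) :
    fderiv ℝ (fderiv ℝ F) y v w = fderiv ℝ (fderiv ℝ F) y w v :=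
  (hF.of_le (m := 2) ENat.LEInfty.out).isSymmSndFDerivAt (by simp) v w

theorem _root_.ContDiffAt.differentiableAt_fderiv {F : E → ℝ} {y : E} (hF : ContDiffAt ℝ ∞ F y) :
    DifferentiableAt ℝ (fderiv ℝ F) y :=
  (hF.fderiv_right (m := 1) (by rw [one_add_one_eq_two]; exact ENat.LEInfty.out)).differentiableAt one_ne_zero

/-- The Lie derivative of the metric `g` along the field `G`, at `y`. -/
def lieForm (g : E → E →L[ℝ] E →L[ℝ] ℝ) (G : E → E) (y v w : E) : ℝ :=
  fderiv ℝ g y (G y) v w + g y (fderiv ℝ G y v) w + g y v (fderiv ℝ G y w)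

/-- The Hessian of `F`, where `G` is the gradient of `F` with respect to `g`. -/
def hessForm (g : E → E →L[ℝ] E →L[ℝ] ℝ) (F : E → ℝ) (G : E → E) (y v w : E) : ℝ :=
  fderiv ℝ (fderiv ℝ F) y v w
    - (1 / 2) * (fderiv ℝ g y v w (G y) + fderiv ℝ g y w v (G y) - fderiv ℝ g y (G y) v w)

variable {g : E → E →L[ℝ] E →L[ℝ] ℝ} {F : E → ℝ} {G : E → E} {y : E}

theorem fderiv_bilin_symm (hsymm : ∀ᶠ z in 𝓝 y, ∀ v w, g z v w = g z w v)
    (hg : DifferentiableAt ℝ g y) (a v w : E) :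
    fderiv ℝ g y a v w = fderiv ℝ g y a w v := by
  rw [← fderiv_bilin_apply hg, ← fderiv_bilin_apply hg]
  have h : (fun z => g z v w) =ᶠ[𝓝 y] fun z => g z w v := hsymm.mono fun z hz => hz v w
  rw [h.fderiv_eq]

/-- The product rule applied to `g(G, w) = dF(w)`. It eliminates all derivatives of the gradient in
favour of those of `g` and `F`. -/
theorem bilin_fderiv_grad (hG : ∀ᶠ z in 𝓝 y, ∀ w, g z (G z) w = fderiv ℝ F z w)
    (hg : DifferentiableAt ℝ g y) (hGd : DifferentiableAt ℝ G y) (hF : ContDiffAt ℝ ∞ F y)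
    (a w : E) :
    g y (fderiv ℝ G y a) w = fderiv ℝ (fderiv ℝ F) y a w - fderiv ℝ g y a (G y) w := by
  have h : (fun z => g z (G z) w) =ᶠ[𝓝 y] fun z => fderiv ℝ F z w := hG.mono fun z hz => hz w
  have h1 := congrArg (fun l : E →L[ℝ] ℝ => l a) h.fderiv_eq
  rw [fderiv_form_apply hF.differentiableAt_fderiv] at h1
  have h2 := (hg.hasFDerivAt.clm_apply hGd.hasFDerivAt).clm_apply (hasFDerivAt_const w y)
  rw [h2.fderiv] at h1
  simp at h1
  linarith

/-- After the derivatives of `G` are eliminated, symmetry of the second derivative leaves twice the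
second derivative minus the Christoffel terms. -/
theorem lieForm_grad (hsymm : ∀ᶠ z in 𝓝 y, ∀ v w, g z v w = g z w v)
    (hG : ∀ᶠ z in 𝓝 y, ∀ w, g z (G z) w = fderiv ℝ F z w)
    (hg : DifferentiableAt ℝ g y) (hGd : DifferentiableAt ℝ G y) (hF : ContDiffAt ℝ ∞ F y)
    (v w : E) : lieForm g G y v w = 2 * hessForm g F G y v w := by
  have hs := hsymm.self_of_nhds
  rw [lieForm, hessForm, hs v, bilin_fderiv_grad hG hg hGd hF, bilin_fderiv_grad hG hg hGd hF,
    fderiv_fderiv_comm hF w v, fderiv_bilin_symm hsymm hg v w, fderiv_bilin_symm hsymm hg w v]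
  ring

theorem fderiv_bilin_grad_grad (hsymm : ∀ᶠ z in 𝓝 y, ∀ v w, g z v w = g z w v)
    (hG : ∀ᶠ z in 𝓝 y, ∀ w, g z (G z) w = fderiv ℝ F z w)
    (hg : DifferentiableAt ℝ g y) (hGd : DifferentiableAt ℝ G y) (hF : ContDiffAt ℝ ∞ F y)
    (w : E) : fderiv ℝ (fun z => g z (G z) (G z)) y w = 2 * hessForm g F G y w (G y) := by
  have hs := hsymm.self_of_nhds
  rw [((hg.hasFDerivAt.clm_apply hGd.hasFDerivAt).clm_apply hGd.hasFDerivAt).fderiv, hessForm]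
  simp only [add_apply, ContinuousLinearMap.coe_comp, Function.comp_apply,
    ContinuousLinearMap.flip_apply]
  rw [hs (G y), bilin_fderiv_grad hG hg hGd hF, fderiv_bilin_symm hsymm hg (G y) w]
  ring

/-- Near `y` the form `g z` is invertible as a map into the dual, so `X z` is `(g z)⁻¹ (α z)`, and
inversion of continuous linear maps is smooth. This gives smooth gradients although `sharp` is
defined by choice. -/
theorem contDiffAt_of_bilin_apply_eq [FiniteDimensional ℝ E] {α : E → E →L[ℝ] ℝ} {X : E → E}
    (hg : ContDiffAt ℝ ∞ g y) (hpos : ∀ v, v ≠ 0 → 0 < g y v v) (hα : ContDiffAt ℝ ∞ α y)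
    (hX : ∀ᶠ z in 𝓝 y, ∀ w, g z (X z) w = α z w) : ContDiffAt ℝ ∞ X y := by
  have hinj : Function.Injective (g y) := by
    rw [injective_iff_map_eq_zero]
    intro v hv
    by_contra hne
    exact (hpos v hne).ne' (by rw [hv]; rfl)
  have hfin : Module.finrank ℝ E = Module.finrank ℝ (E →L[ℝ] ℝ) := by
    rw [← (LinearMap.toContinuousLinearMap (𝕜 := ℝ) (E := E) (F' := ℝ)).finrank_eq]
    exact (Subspace.dual_finrank_eq (K := ℝ) (V := E)).symm
  let e : E ≃L[ℝ] (E →L[ℝ] ℝ) :=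
    (LinearEquiv.ofInjectiveOfFinrankEq (g y : E →ₗ[ℝ] E →L[ℝ] ℝ) hinj hfin).toContinuousLinearEquiv
  have he : (e : E →L[ℝ] E →L[ℝ] ℝ) = g y := by ext v w; rfl
  have hinv : ContDiffAt ℝ ∞ (fun z => ContinuousLinearMap.inverse (g z)) y := by
    have h := contDiffAt_map_inverse (𝕜 := ℝ) (n := ∞) e
    rw [he] at h
    exact h.comp y hg
  refine (hinv.clm_apply hα).congr_of_eventuallyEq ?_
  have hunit : ∀ᶠ z in 𝓝 y, g z ∈ range ((↑) : (E ≃L[ℝ] (E →L[ℝ] ℝ)) → E →L[ℝ] E →L[ℝ] ℝ) := by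
    refine hg.continuousAt.eventually ?_
    rw [← he]
    exact ContinuousLinearEquiv.nhds e
  filter_upwards [hunit, hX] with z hz hXz
  obtain ⟨e', he'⟩ := hz
  rw [← he', ContinuousLinearMap.inverse_equiv]
  have : α z = e' (X z) := by
    ext w; rw [← hXz w, ← he']; rfl
  rw [this]; simp

/-- The coefficient of `dv` times a one-form on the cut, in the Lie derivative of the near horizon
metric. -/
def mixedForm (σ : E → E →L[ℝ] ℝ) (h F Φ : E → ℝ) (G : E → E) (y w : E) : ℝ :=
  h y * fderiv ℝ F y w + 1 / 2 * fderiv ℝ Φ y w + Φ y * σ y w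
    - 2 * (fderiv ℝ σ y (G y) w + σ y (fderiv ℝ G y w))

/-- The near horizon metric in coordinates. -/
def nearHorizonForm (g : E → E →L[ℝ] E →L[ℝ] ℝ) (σ : E → E →L[ℝ] ℝ) (h : E → ℝ)
    (p X Y : ℝ × ℝ × E) : ℝ :=
  X.1 * (Y.2.1 + 2 * p.2.1 * σ p.2.2 Y.2.2 + 1 / 2 * p.2.1 ^ 2 * h p.2.2 * Y.1)
    + Y.1 * (X.2.1 + 2 * p.2.1 * σ p.2.2 X.2.2 + 1 / 2 * p.2.1 ^ 2 * h p.2.2 * X.1)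
    + g p.2.2 X.2.2 Y.2.2

/-- The vector field `F ∂_v + (u²/2) Φ ∂_u - u G` in coordinates. -/
def nearHorizonField (F Φ : E → ℝ) (G : E → E) (p : ℝ × ℝ × E) : ℝ × ℝ × E :=
  (F p.2.2, p.2.1 ^ 2 / 2 * Φ p.2.2, -p.2.1 • G p.2.2)

variable {σ : E → E →L[ℝ] ℝ} {h Φ : E → ℝ}

theorem hasFDerivAt_comp_snd_snd {V : Type*} [NormedAddCommGroup V] [NormedSpace ℝ V]
    {f : E → V} {p : ℝ × ℝ × E} (hf : DifferentiableAt ℝ f p.2.2) :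
    HasFDerivAt (fun q : ℝ × ℝ × E => f q.2.2) ((fderiv ℝ f p.2.2).comp
      ((ContinuousLinearMap.snd ℝ ℝ E).comp (ContinuousLinearMap.snd ℝ ℝ (ℝ × E)))) p :=
  hf.hasFDerivAt.comp p ((hasFDerivAt_snd (p := p.2)).comp p hasFDerivAt_snd)

theorem hasFDerivAt_snd_fst (p : ℝ × ℝ × E) :
    HasFDerivAt (fun q : ℝ × ℝ × E => q.2.1)
      ((ContinuousLinearMap.fst ℝ ℝ E).comp (ContinuousLinearMap.snd ℝ ℝ (ℝ × E))) p :=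
  (hasFDerivAt_fst (p := p.2)).comp p hasFDerivAt_snd

theorem fderiv_nearHorizonField {p : ℝ × ℝ × E} (hF : DifferentiableAt ℝ F p.2.2)
    (hΦ : DifferentiableAt ℝ Φ p.2.2) (hG : DifferentiableAt ℝ G p.2.2) (X : ℝ × ℝ × E) :
    fderiv ℝ (nearHorizonField F Φ G) p X =
      (fderiv ℝ F p.2.2 X.2.2,
        p.2.1 * Φ p.2.2 * X.2.1 + p.2.1 ^ 2 / 2 * fderiv ℝ Φ p.2.2 X.2.2,
        -(X.2.1 • G p.2.2) - p.2.1 • fderiv ℝ G p.2.2 X.2.2) := by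
  have hu := hasFDerivAt_snd_fst p
  have h1 := hasFDerivAt_comp_snd_snd hF
  have h2 := ((hu.pow 2).mul_const (2 : ℝ)⁻¹).mul (hasFDerivAt_comp_snd_snd hΦ)
  have h3 := hu.neg.smul (hasFDerivAt_comp_snd_snd hG)
  have h4 := h1.prodMk (h2.prodMk h3)
  have h5 : fderiv ℝ (nearHorizonField F Φ G) p = _ := h4.fderiv
  rw [h5]
  simp
  refine ⟨by ring, ?_⟩
  abel

theorem fderiv_nearHorizonForm {p : ℝ × ℝ × E} (hg : DifferentiableAt ℝ g p.2.2)
    (hσ : DifferentiableAt ℝ σ p.2.2) (hh : DifferentiableAt ℝ h p.2.2) (X Y Z : ℝ × ℝ × E) :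
    fderiv ℝ (fun q => nearHorizonForm g σ h q X Y) p Z =
      X.1 * (2 * Z.2.1 * σ p.2.2 Y.2.2 + 2 * p.2.1 * fderiv ℝ σ p.2.2 Z.2.2 Y.2.2
          + (p.2.1 * Z.2.1 * h p.2.2 + 1 / 2 * p.2.1 ^ 2 * fderiv ℝ h p.2.2 Z.2.2) * Y.1)
        + Y.1 * (2 * Z.2.1 * σ p.2.2 X.2.2 + 2 * p.2.1 * fderiv ℝ σ p.2.2 Z.2.2 X.2.2
          + (p.2.1 * Z.2.1 * h p.2.2 + 1 / 2 * p.2.1 ^ 2 * fderiv ℝ h p.2.2 Z.2.2) * X.1)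
        + fderiv ℝ g p.2.2 Z.2.2 X.2.2 Y.2.2 := by
  have hu := hasFDerivAt_snd_fst p
  have hσ' := fun w => (hasFDerivAt_comp_snd_snd hσ).clm_apply (hasFDerivAt_const w p)
  have hg' := hasFDerivAt_comp_snd_snd (p := p)
    (hasFDerivAt_bilin_apply hg X.2.2 Y.2.2).differentiableAt
  have hc := fun (w : E) (a b : ℝ) => (((hasFDerivAt_const b p).add
    ((hu.const_mul 2).mul (hσ' w))).add
      ((((hu.pow 2).const_mul (1 / 2)).mul (hasFDerivAt_comp_snd_snd hh)).mul_const a))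
  have h4 := (((hc Y.2.2 Y.1 Y.2.1).const_mul X.1).add
    ((hc X.2.2 X.1 X.2.1).const_mul Y.1)).add hg'
  have h5 : fderiv ℝ (fun q => nearHorizonForm g σ h q X Y) p = _ := h4.fderiv
  rw [h5]
  simp [fderiv_bilin_apply hg]
  ring

set_option synthInstance.maxHeartbeats 200000 in
-- Since `G` is the gradient of `F`, the `du dx` terms cancel: `dF` comes from the `∂_v` component
-- of the field and `-g(G, ·)` from the `u`-derivative of `-u G`. Every surviving term contains `u`.
theorem lie_nearHorizonForm {p : ℝ × ℝ × E} (hg : DifferentiableAt ℝ g p.2.2)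
    (hσ : DifferentiableAt ℝ σ p.2.2) (hh : DifferentiableAt ℝ h p.2.2)
    (hF : DifferentiableAt ℝ F p.2.2) (hΦ : DifferentiableAt ℝ Φ p.2.2)
    (hG : DifferentiableAt ℝ G p.2.2) (hsymm : ∀ v w, g p.2.2 v w = g p.2.2 w v)
    (hgrad : ∀ w, g p.2.2 (G p.2.2) w = fderiv ℝ F p.2.2 w) (X Y : ℝ × ℝ × E) :
    fderiv ℝ (fun q => nearHorizonForm g σ h q X Y) p (nearHorizonField F Φ G p)
      + nearHorizonForm g σ h p (fderiv ℝ (nearHorizonField F Φ G) p X) Y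
      + nearHorizonForm g σ h p X (fderiv ℝ (nearHorizonField F Φ G) p Y) =
    p.2.1 * (Φ p.2.2 - 2 * σ p.2.2 (G p.2.2)) * (X.1 * Y.2.1 + Y.1 * X.2.1)
      + p.2.1 ^ 2 * (X.1 * mixedForm σ h F Φ G p.2.2 Y.2.2
          + Y.1 * mixedForm σ h F Φ G p.2.2 X.2.2)
      + p.2.1 ^ 3 * (Φ p.2.2 * h p.2.2 - fderiv ℝ h p.2.2 (G p.2.2)) * (X.1 * Y.1)
      + 2 * p.2.1 * (fderiv ℝ F p.2.2 X.2.2 * σ p.2.2 Y.2.2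
          + fderiv ℝ F p.2.2 Y.2.2 * σ p.2.2 X.2.2)
      - p.2.1 * lieForm g G p.2.2 X.2.2 Y.2.2 := by
  rw [fderiv_nearHorizonForm hg hσ hh, fderiv_nearHorizonField hF hΦ hG,
    fderiv_nearHorizonField hF hΦ hG]
  simp only [nearHorizonForm, nearHorizonField, mixedForm, lieForm, map_sub, map_neg, map_smul,
    smul_eq_mul, sub_apply, neg_apply, smul_apply, hgrad, hsymm X.2.2 (G p.2.2)]
  ring

set_option synthInstance.maxHeartbeats 200000 in
/-- The Lie derivative of `g` along `k G`, where `G` is the gradient of `F`. -/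
theorem lieForm_smul {k : E → ℝ} (hk : DifferentiableAt ℝ k y) (hGd : DifferentiableAt ℝ G y)
    (hsymm : ∀ v w, g y v w = g y w v) (hgrad : ∀ w, g y (G y) w = fderiv ℝ F y w) (v w : E) :
    lieForm g (fun z => k z • G z) y v w = k y * lieForm g G y v w
      + (fderiv ℝ k y v * fderiv ℝ F y w + fderiv ℝ k y w * fderiv ℝ F y v) := by
  have h1 : fderiv ℝ (fun z => k z • G z) y = _ := (hk.hasFDerivAt.smul hGd.hasFDerivAt).fderiv
  simp only [lieForm, h1]
  simp [hgrad, hsymm v (G y)]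
  ring

/-- The part `dN/N` is the differential of `log |N|`, hence closed; only `-½ dp ∧ dF` contributes.
-/
theorem fderiv_skew_of_eventuallyEq {N p : E → ℝ} (hN : ContDiffAt ℝ ∞ N y) (hN0 : N y ≠ 0)
    (hp : DifferentiableAt ℝ p y) (hF : ContDiffAt ℝ ∞ F y)
    (hσ : ∀ᶠ z in 𝓝 y, σ z = (1 / 2 : ℝ) • ((N z)⁻¹ • fderiv ℝ N z - p z • fderiv ℝ F z))
    (v w : E) :
    fderiv ℝ σ y v w - fderiv ℝ σ y w v
      = -(1 / 2) * (fderiv ℝ p y v * fderiv ℝ F y w - fderiv ℝ p y w * fderiv ℝ F y v) := by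
  have hNd : DifferentiableAt ℝ N y := hN.differentiableAt (by simp)
  have h1 := ((((hasDerivAt_inv hN0).comp_hasFDerivAt y hNd.hasFDerivAt).smul
    hN.differentiableAt_fderiv.hasFDerivAt).sub
    (hp.hasFDerivAt.smul hF.differentiableAt_fderiv.hasFDerivAt)).const_smul (1 / 2 : ℝ)
  have h2 : fderiv ℝ σ y = _ := (Filter.EventuallyEq.fderiv_eq hσ).trans h1.fderiv
  rw [h2]
  simp [fderiv_fderiv_comm hN v w, fderiv_fderiv_comm hF v w]
  ring

/-- Locally, `dp = c dF` implies `dc ∧ dF = 0`. -/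
theorem fderiv_mul_comm_of_eventuallyEq {p c : E → ℝ} (hp : ContDiffAt ℝ ∞ p y)
    (hF : ContDiffAt ℝ ∞ F y) (hc : DifferentiableAt ℝ c y)
    (h : ∀ᶠ z in 𝓝 y, fderiv ℝ p z = c z • fderiv ℝ F z) (v w : E) :
    fderiv ℝ c y v * fderiv ℝ F y w = fderiv ℝ c y w * fderiv ℝ F y v := by
  -- Symmetry of the second derivative of `p`, compared with the derivative of `c dF`; the term with
  -- the second derivative of `F` is itself symmetric.
  have h1 := hc.hasFDerivAt.smul hF.differentiableAt_fderiv.hasFDerivAt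
  have h2 : fderiv ℝ (fderiv ℝ p) y = _ := (Filter.EventuallyEq.fderiv_eq h).trans h1.fderiv
  have h3 := fderiv_fderiv_comm hp v w
  rw [h2] at h3
  simp [fderiv_fderiv_comm hF v w] at h3
  linarith

end LocalCalculus

/-! ### Gradient, Hessian and Laplacian on the cut -/

section Cut

variable {d : ℕ} {S : Type*} [TopologicalSpace S] [ChartedSpace (EuclideanSpace ℝ (Fin d)) S]

/-- The components of a one-form in the chart at `x`, as a continuous linear form. -/
def localCovector (α : Π x : S, TangentSpace (𝓡 d) x →L[ℝ] ℝ) (x : S)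
    (y : EuclideanSpace ℝ (Fin d)) : EuclideanSpace ℝ (Fin d) →L[ℝ] ℝ :=
  (α ((extChartAt (𝓡 d) x).symm y)).comp
    (mfderiv 𝓘(ℝ, EuclideanSpace ℝ (Fin d)) (𝓡 d) (extChartAt (𝓡 d) x).symm y)

theorem localCovector_apply (α : Π x : S, TangentSpace (𝓡 d) x →L[ℝ] ℝ) (x : S)
    (y v : EuclideanSpace ℝ (Fin d)) :
    localCovector α x y v = localOneForm (𝓡 d) α x y v := rfl

/-- `f` in the chart at `x`. -/
def localFun (f : S → ℝ) (x : S) (y : EuclideanSpace ℝ (Fin d)) : ℝ :=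
  f ((extChartAt (𝓡 d) x).symm y)

theorem localFun_self (f : S → ℝ) (x : S) : localFun f x (extChartAt (𝓡 d) x x) = f x := by
  rw [localFun, extChartAt_to_inv]

theorem contDiffAt_localFun {f : S → ℝ} {x : S} (hf : ContMDiffAt (𝓡 d) 𝓘(ℝ, ℝ) ∞ f x) :
    ContDiffAt ℝ ∞ (localFun f x) (extChartAt (𝓡 d) x x) :=
  hf.contDiffAt_comp_symm (𝓡 d)

theorem differentiableAt_localFun {f : S → ℝ} (hf : ContMDiff (𝓡 d) 𝓘(ℝ, ℝ) ∞ f) (x : S) :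
    DifferentiableAt ℝ (localFun f x) (extChartAt (𝓡 d) x x) :=
  (contDiffAt_localFun hf.contMDiffAt).differentiableAt (by simp)

theorem extDerivOneForm_eq {α : Π x : S, TangentSpace (𝓡 d) x →L[ℝ] ℝ} {x : S}
    (hα : DifferentiableAt ℝ (localCovector α x) (extChartAt (𝓡 d) x x))
    (v w : EuclideanSpace ℝ (Fin d)) :
    extDerivOneForm (𝓡 d) α x v w
      = fderiv ℝ (localCovector α x) (extChartAt (𝓡 d) x x) v w
        - fderiv ℝ (localCovector α x) (extChartAt (𝓡 d) x x) w v := by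
  rw [← fderiv_form_apply hα, ← fderiv_form_apply hα]
  rfl

variable [IsManifold (𝓡 d) ∞ S]

/-- The components of the metric in the chart at `x`, as a continuous bilinear form. -/
def localForm (γ : RiemMetric d S) (x : S) (y : EuclideanSpace ℝ (Fin d)) :
    EuclideanSpace ℝ (Fin d) →L[ℝ] EuclideanSpace ℝ (Fin d) →L[ℝ] ℝ :=
  let A : EuclideanSpace ℝ (Fin d) →L[ℝ] EuclideanSpace ℝ (Fin d) :=
    mfderiv 𝓘(ℝ, EuclideanSpace ℝ (Fin d)) (𝓡 d) (extChartAt (𝓡 d) x).symm y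
  let B : EuclideanSpace ℝ (Fin d) →L[ℝ] EuclideanSpace ℝ (Fin d) →L[ℝ] ℝ :=
    γ.inner ((extChartAt (𝓡 d) x).symm y)
  B.bilinearComp A A

theorem localForm_apply (γ : RiemMetric d S) (x : S) (y v w : EuclideanSpace ℝ (Fin d)) :
    localForm γ x y v w = localMetric (𝓡 d) γ.form x y v w := rfl

theorem localForm_symm (γ : RiemMetric d S) (x : S) (y v w : EuclideanSpace ℝ (Fin d)) :
    localForm γ x y v w = localForm γ x y w v :=
  γ.symm _ _ _

theorem form_symm (γ : RiemMetric d S) (x : S) (X Y : TangentSpace (𝓡 d) x) :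
    γ.form x X Y = γ.form x Y X :=
  γ.symm _ _ _

theorem localForm_self (γ : RiemMetric d S) (x : S) (v w : EuclideanSpace ℝ (Fin d)) :
    localForm γ x (extChartAt (𝓡 d) x x) v w = γ.form x v w :=
  localMetric_self (𝓡 d) γ.form x v w

theorem localCovector_self (α : Π x : S, TangentSpace (𝓡 d) x →L[ℝ] ℝ) (x : S)
    (v : EuclideanSpace ℝ (Fin d)) :
    localCovector α x (extChartAt (𝓡 d) x x) v = α x v :=
  localOneForm_self (𝓡 d) α x v

theorem localForm_pos (γ : RiemMetric d S) (x : S) (v : EuclideanSpace ℝ (Fin d)) (hv : v ≠ 0) :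
    0 < localForm γ x (extChartAt (𝓡 d) x x) v v := by
  rw [localForm_self]; exact γ.pos x v hv

theorem contDiffAt_localForm (γ : RiemMetric d S) (x : S) :
    ContDiffAt ℝ ∞ (localForm γ x) (extChartAt (𝓡 d) x x) := by
  have h : ContDiffOn ℝ ∞ (localForm γ x) (extChartAt (𝓡 d) x).target :=
    contDiffOn_clm_apply.2 fun v => contDiffOn_clm_apply.2 fun w =>
      contDiffOn_localMetric (𝓡 d) γ.contMDiff x v w
  exact h.contDiffAt (extChartAt_target_mem_nhds x)

theorem differentiableAt_localForm (γ : RiemMetric d S) (x : S) :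
    DifferentiableAt ℝ (localForm γ x) (extChartAt (𝓡 d) x x) :=
  (contDiffAt_localForm γ x).differentiableAt (by simp)

theorem Data.contDiffAt_localCovector (D : Data d S) (x : S) :
    ContDiffAt ℝ ∞ (localCovector D.s x) (extChartAt (𝓡 d) x x) := by
  have h : ContDiffOn ℝ ∞ (localCovector D.s x) (extChartAt (𝓡 d) x).target :=
    contDiffOn_clm_apply.2 fun v => contDiffOn_localOneForm (𝓡 d) D.smooth_s x v
  exact h.contDiffAt (extChartAt_target_mem_nhds x)

theorem localCovector_diff {f : S → ℝ} (hf : ContMDiff (𝓡 d) 𝓘(ℝ, ℝ) ∞ f) {x : S}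
    {y : EuclideanSpace ℝ (Fin d)} (hy : y ∈ (extChartAt (𝓡 d) x).target) :
    localCovector (diff (𝓡 d) f) x y = fderiv ℝ (localFun f x) y := by
  ext v
  exact (fderiv_comp_symm (𝓡 d) hy (hf.mdifferentiable (by simp) _) v).symm

theorem diff_apply {f : S → ℝ} (hf : ContMDiff (𝓡 d) 𝓘(ℝ, ℝ) ∞ f) (x : S)
    (v : EuclideanSpace ℝ (Fin d)) :
    diff (𝓡 d) f x v = fderiv ℝ (localFun f x) (extChartAt (𝓡 d) x x) v :=
  diff_apply_eq_fderiv (𝓡 d) (hf.mdifferentiable (by simp) x) v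

theorem localForm_localField_sharp (γ : RiemMetric d S)
    (α : Π x : S, TangentSpace (𝓡 d) x →L[ℝ] ℝ) {x : S} {y : EuclideanSpace ℝ (Fin d)}
    (hy : y ∈ (extChartAt (𝓡 d) x).target) (w : EuclideanSpace ℝ (Fin d)) :
    localForm γ x y (localField (𝓡 d) (fun q => sharp γ q (α q)) x y) w
      = localCovector α x y w := by
  rw [localForm_apply, localMetric, ofComponents_localField (𝓡 d) hy, form_sharp]
  rfl

theorem eventually_localForm_localField_sharp (γ : RiemMetric d S)
    (α : Π x : S, TangentSpace (𝓡 d) x →L[ℝ] ℝ) (x : S) :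
    ∀ᶠ y in 𝓝 (extChartAt (𝓡 d) x x), ∀ w,
      localForm γ x y (localField (𝓡 d) (fun q => sharp γ q (α q)) x y) w
        = localCovector α x y w := by
  filter_upwards [extChartAt_target_mem_nhds x] with y hy w
  exact localForm_localField_sharp γ α hy w

theorem contDiffAt_localField_sharp (γ : RiemMetric d S)
    (α : Π x : S, TangentSpace (𝓡 d) x →L[ℝ] ℝ) {x : S}
    (hα : ContDiffAt ℝ ∞ (localCovector α x) (extChartAt (𝓡 d) x x)) :
    ContDiffAt ℝ ∞ (localField (𝓡 d) (fun q => sharp γ q (α q)) x) (extChartAt (𝓡 d) x x) :=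
  contDiffAt_of_bilin_apply_eq (contDiffAt_localForm γ x) (localForm_pos γ x) hα
    (eventually_localForm_localField_sharp γ α x)

theorem eventually_localCovector_diff {f : S → ℝ} (hf : ContMDiff (𝓡 d) 𝓘(ℝ, ℝ) ∞ f) (x : S) :
    localCovector (diff (𝓡 d) f) x =ᶠ[𝓝 (extChartAt (𝓡 d) x x)] fderiv ℝ (localFun f x) := by
  filter_upwards [extChartAt_target_mem_nhds x] with y hy using localCovector_diff hf hy

theorem contDiffAt_localCovector_diff {f : S → ℝ} (hf : ContMDiff (𝓡 d) 𝓘(ℝ, ℝ) ∞ f) (x : S) :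
    ContDiffAt ℝ ∞ (localCovector (diff (𝓡 d) f) x) (extChartAt (𝓡 d) x x) :=
  ((contDiffAt_localFun hf.contMDiffAt).fderiv_right (m := ∞) (by simp)).congr_of_eventuallyEq
    (eventually_localCovector_diff hf x)

variable (γ : RiemMetric d S) {f : S → ℝ}

theorem contDiffAt_localField_grad (hf : ContMDiff (𝓡 d) 𝓘(ℝ, ℝ) ∞ f) (x : S) :
    ContDiffAt ℝ ∞ (localField (𝓡 d) (grad γ f) x) (extChartAt (𝓡 d) x x) :=
  contDiffAt_localField_sharp γ (diff (𝓡 d) f) (contDiffAt_localCovector_diff hf x)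

theorem differentiableAt_localField_grad (hf : ContMDiff (𝓡 d) 𝓘(ℝ, ℝ) ∞ f) (x : S) :
    DifferentiableAt ℝ (localField (𝓡 d) (grad γ f) x) (extChartAt (𝓡 d) x x) :=
  (contDiffAt_localField_grad γ hf x).differentiableAt (by simp)

theorem eventually_localForm_grad (hf : ContMDiff (𝓡 d) 𝓘(ℝ, ℝ) ∞ f) (x : S) :
    ∀ᶠ y in 𝓝 (extChartAt (𝓡 d) x x), ∀ w,
      localForm γ x y (localField (𝓡 d) (grad γ f) x y) w = fderiv ℝ (localFun f x) y w := by
  filter_upwards [eventually_localForm_localField_sharp γ (diff (𝓡 d) f) x,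
    eventually_localCovector_diff hf x] with y h1 h2 w
  rw [← h2]; exact h1 w

theorem normSq_eq_diff (f : S → ℝ) (x : S) : normSq γ f x = diff (𝓡 d) f x (grad γ f x) :=
  form_sharp γ x _ _

theorem form_self_nonneg (x : S) (X : TangentSpace (𝓡 d) x) : 0 ≤ γ.form x X X := by
  by_cases hX : X = 0
  · rw [hX]; simp [RiemMetric.form]
  · exact (γ.pos x X hX).le

theorem normSq_nonneg (f : S → ℝ) (x : S) : 0 ≤ normSq γ f x := form_self_nonneg γ x _

theorem normSq_eq_zero_iff {x : S} : normSq γ f x = 0 ↔ diff (𝓡 d) f x = 0 := by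
  constructor
  · intro h
    have hg : grad γ f x = 0 := by
      by_contra hne
      exact (γ.pos x _ hne).ne' h
    ext Y
    rw [← form_sharp γ x (diff (𝓡 d) f x) Y, show sharp γ x (diff (𝓡 d) f x) = 0 from hg]
    simp [RiemMetric.form]
  · intro h
    rw [normSq_eq_diff, h]; rfl

theorem localFun_eq_diff_grad {α : Π x : S, TangentSpace (𝓡 d) x →L[ℝ] ℝ}
    (X : Π x : S, TangentSpace (𝓡 d) x) {x : S} {y : EuclideanSpace ℝ (Fin d)}
    (hy : y ∈ (extChartAt (𝓡 d) x).target) :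
    localFun (fun q => α q (X q)) x y = localCovector α x y (localField (𝓡 d) X x y) := by
  rw [localCovector_apply, localOneForm, ofComponents_localField (𝓡 d) hy]; rfl

theorem contMDiff_apply_grad {α : Π x : S, TangentSpace (𝓡 d) x →L[ℝ] ℝ}
    (hα : ∀ x, ContDiffAt ℝ ∞ (localCovector α x) (extChartAt (𝓡 d) x x))
    (hf : ContMDiff (𝓡 d) 𝓘(ℝ, ℝ) ∞ f) :
    ContMDiff (𝓡 d) 𝓘(ℝ, ℝ) ∞ (fun x => α x (grad γ f x)) := by
  intro x
  rw [contMDiffAt_iff_contDiffAt_comp_symm]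
  refine ((hα x).clm_apply (contDiffAt_localField_grad γ hf x)).congr_of_eventuallyEq ?_
  filter_upwards [extChartAt_target_mem_nhds x] with y hy
    using localFun_eq_diff_grad (grad γ f) hy

theorem contMDiff_normSq (hf : ContMDiff (𝓡 d) 𝓘(ℝ, ℝ) ∞ f) :
    ContMDiff (𝓡 d) 𝓘(ℝ, ℝ) ∞ (normSq γ f) := by
  rw [funext (normSq_eq_diff γ f)]
  exact contMDiff_apply_grad γ (fun x => contDiffAt_localCovector_diff hf x) hf

theorem hessian_eq_hessForm (x : S) (v w : EuclideanSpace ℝ (Fin d))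
    (hf : ContMDiff (𝓡 d) 𝓘(ℝ, ℝ) ∞ f) :
    hessian γ f x v w = hessForm (localForm γ x) (localFun f x) (localField (𝓡 d) (grad γ f) x)
      (extChartAt (𝓡 d) x x) v w := by
  have hg := differentiableAt_localForm γ x
  have hG : components (𝓡 d) x x (grad γ f x)
      = localField (𝓡 d) (grad γ f) x (extChartAt (𝓡 d) x x) := by
    rw [localField_self, components_self]
  rw [hessForm, ← fderiv_bilin_apply hg, ← fderiv_bilin_apply hg, ← fderiv_bilin_apply hg,
    ← fderiv_form_apply (contDiffAt_localFun hf.contMDiffAt).differentiableAt_fderiv, ← hG]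
  rfl

theorem lieDerivMetric_eq_lieForm (X : Π x : S, TangentSpace (𝓡 d) x) (x : S)
    (v w : EuclideanSpace ℝ (Fin d)) :
    lieDerivMetric (𝓡 d) γ.form X x v w
      = lieForm (localForm γ x) (localField (𝓡 d) X x) (extChartAt (𝓡 d) x x) v w := by
  rw [lieForm, ← fderiv_bilin_apply (differentiableAt_localForm γ x)]
  rfl

/-- By metric compatibility: the derivative of `γ(grad f, grad f)` is `2 γ(D grad f, grad f)`. In
coordinates this is `fderiv_bilin_grad_grad`. -/
theorem diff_normSq (hf : ContMDiff (𝓡 d) 𝓘(ℝ, ℝ) ∞ f) (x : S) (w : EuclideanSpace ℝ (Fin d)) :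
    diff (𝓡 d) (normSq γ f) x w = 2 * hessian γ f x w (grad γ f x) := by
  refine (diff_apply (contMDiff_normSq γ hf) x w).trans (Eq.trans ?_
    (congrArg (2 * ·) (hessian_eq_hessForm γ x w (grad γ f x) hf)).symm)
  have h := fderiv_bilin_grad_grad
    (Filter.Eventually.of_forall fun z v w => localForm_symm γ x z v w)
    (eventually_localForm_grad γ hf x) (differentiableAt_localForm γ x)
    (differentiableAt_localField_grad γ hf x) (contDiffAt_localFun hf.contMDiffAt) w
  rw [localField_self] at h
  refine Eq.trans ?_ h
  refine congrArg (fun l : EuclideanSpace ℝ (Fin d) →L[ℝ] ℝ => l w) (Filter.EventuallyEq.fderiv_eq ?_)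
  filter_upwards [extChartAt_target_mem_nhds x] with y hy
  rw [localForm_apply, localMetric, ofComponents_localField (𝓡 d) hy]
  rfl

/-- The trace of a symmetrized product with `df`. -/
theorem laplacian_of_hessian_eq (x : S) (σ : TangentSpace (𝓡 d) x →L[ℝ] ℝ)
    (h : ∀ v w : EuclideanSpace ℝ (Fin d), hessian γ f x v w
      = diff (𝓡 d) f x v * σ w + diff (𝓡 d) f x w * σ v) :
    laplacian γ f x = 2 * σ (grad γ f x) := by
  let E := EuclideanSpace ℝ (Fin d)
  let e : Fin d → E := fun i => EuclideanSpace.single i 1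
  -- The basis reciprocal to `e` with respect to `γ`: `γ(c i, Y)` is the `i`-th component of `Y`.
  -- Contracting over `e i` and `c i` is the metric trace.
  let c : Fin d → TangentSpace (𝓡 d) x := fun i => sharp γ x (coordForm x i)
  have hc : ∀ i (Y : E), γ.form x (c i) Y = Y i := by
    intro i Y
    exact (form_sharp γ x (coordForm x i) Y).trans
      (congrArg (fun Z : E => Z i) (components_self (𝓡 d) x Y))
  have hsum : ∀ Y : E, ∑ i, Y i • e i = Y := by
    intro Y
    have := (EuclideanSpace.basisFun (Fin d) ℝ).sum_repr Y
    simpa [e] using this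
  have hdual : ∀ (α : E →L[ℝ] ℝ) (Y : E), ∑ i, Y i * α (e i) = α Y := by
    intro α Y
    have h1 := congrArg (fun Z : E => α Z) (hsum Y)
    simp only [map_sum, map_smul, smul_eq_mul] at h1
    exact h1
  have h1 : laplacian γ f x = ∑ i, (diff (𝓡 d) f x (e i) * σ (c i)
      + diff (𝓡 d) f x (c i) * σ (e i)) := by
    refine Finset.sum_congr rfl fun i _ => ?_
    rw [components_self]
    exact h _ _
  have h2 : ∀ i, diff (𝓡 d) f x (c i) = (show E from grad γ f x) i := by
    intro i
    exact (form_sharp γ x (diff (𝓡 d) f x) (c i)).symm.trans ((form_symm γ x _ _).trans (hc i _))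
  have h3 : ∀ i, σ (c i) = (show E from sharp γ x σ) i := by
    intro i
    exact (form_sharp γ x σ (c i)).symm.trans ((form_symm γ x _ _).trans (hc i _))
  have h4 := hdual σ (grad γ f x)
  have h5 := hdual (diff (𝓡 d) f x) (sharp γ x σ)
  have h6 : diff (𝓡 d) f x (sharp γ x σ) = σ (grad γ f x) := by
    rw [← form_sharp γ x (diff (𝓡 d) f x), form_symm, form_sharp]; rfl
  rw [h1, Finset.sum_add_distrib, two_mul]
  congr 1
  · refine Eq.trans ?_ (h5.trans h6)
    exact Finset.sum_congr rfl fun i _ => by rw [h3, mul_comm]; rfl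
  · refine Eq.trans ?_ h4
    exact Finset.sum_congr rfl fun i _ => by rw [h2]; rfl

end Cut

/-! ### Reduction of the spacetime tensors to coordinates on `ℝ × ℝ × S` -/

section Spacetime

variable {d : ℕ} {S : Type*} [TopologicalSpace S] [ChartedSpace (EuclideanSpace ℝ (Fin d)) S]

theorem extChartAt_model (p : ℝ × ℝ × S) :
    extChartAt (model d) p = (PartialEquiv.refl ℝ).prod
      ((PartialEquiv.refl ℝ).prod (extChartAt (𝓡 d) p.2.2)) := by
  rw [extChartAt_prod, extChartAt_prod, extChartAt_model_space_eq_id,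
    extChartAt_model_space_eq_id]

theorem extChartAt_model_apply (p q : ℝ × ℝ × S) :
    extChartAt (model d) p q = (q.1, q.2.1, extChartAt (𝓡 d) p.2.2 q.2.2) := by
  rw [extChartAt_model]; rfl

theorem extChartAt_model_symm (p : ℝ × ℝ × S) :
    ((extChartAt (model d) p).symm : ℝ × ℝ × EuclideanSpace ℝ (Fin d) → ℝ × ℝ × S)
      = Prod.map id (Prod.map id (extChartAt (𝓡 d) p.2.2).symm) := by
  rw [extChartAt_model]; rfl

theorem mem_extChartAt_model_target {p : ℝ × ℝ × S} {q : ℝ × ℝ × EuclideanSpace ℝ (Fin d)} :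
    q ∈ (extChartAt (model d) p).target ↔ q.2.2 ∈ (extChartAt (𝓡 d) p.2.2).target := by
  rw [extChartAt_model]; simp [PartialEquiv.prod_target, mem_prod]

theorem extChartAt_model_self_eventually (p : ℝ × ℝ × S) :
    ∀ᶠ q in 𝓝 (extChartAt (model d) p p), q.2.2 ∈ (extChartAt (𝓡 d) p.2.2).target := by
  filter_upwards [extChartAt_target_mem_nhds (I := model d) p] with q hq
  exact mem_extChartAt_model_target.1 hq

variable [IsManifold (𝓡 d) ∞ S]

/-- The chart of the product is the identity in `v` and `u` times the chart of `S`, so its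
derivative is block diagonal. -/
theorem ofComponents_model (p : ℝ × ℝ × S) {q : ℝ × ℝ × EuclideanSpace ℝ (Fin d)}
    (hq : q.2.2 ∈ (extChartAt (𝓡 d) p.2.2).target) (X : ℝ × ℝ × EuclideanSpace ℝ (Fin d)) :
    (ofComponents (model d) p q X : ℝ × ℝ × EuclideanSpace ℝ (Fin d))
      = (X.1, X.2.1, ofComponents (𝓡 d) p.2.2 q.2.2 X.2.2) := by
  let A : EuclideanSpace ℝ (Fin d) →L[ℝ] EuclideanSpace ℝ (Fin d) :=
    mfderiv 𝓘(ℝ, EuclideanSpace ℝ (Fin d)) (𝓡 d) (extChartAt (𝓡 d) p.2.2).symm q.2.2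
  let L : ℝ × ℝ × EuclideanSpace ℝ (Fin d) →L[ℝ] ℝ × ℝ × EuclideanSpace ℝ (Fin d) :=
    (ContinuousLinearMap.id ℝ ℝ).prodMap ((ContinuousLinearMap.id ℝ ℝ).prodMap A)
  have h1 := (mdifferentiableAt_extChartAt_symm (𝓡 d) hq).hasMFDerivAt
  have h2 : HasFDerivAt (fun z => extChartAt (𝓡 d) ((extChartAt (𝓡 d) p.2.2).symm q.2.2)
      ((extChartAt (𝓡 d) p.2.2).symm z)) A q.2.2 := by
    have h : HasFDerivWithinAt (fun z => extChartAt (𝓡 d) ((extChartAt (𝓡 d) p.2.2).symm q.2.2)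
      ((extChartAt (𝓡 d) p.2.2).symm z)) A (range (𝓡 d)) q.2.2 := h1.2
    rwa [(𝓡 d).range_eq_univ, hasFDerivWithinAt_univ] at h
  have h3 : HasMFDerivAt 𝓘(ℝ, ℝ × ℝ × EuclideanSpace ℝ (Fin d)) (model d)
      (Prod.map id (Prod.map id (extChartAt (𝓡 d) p.2.2).symm)) q L := by
    have h4 : HasFDerivAt (Prod.map id (Prod.map id fun z => extChartAt (𝓡 d)
        ((extChartAt (𝓡 d) p.2.2).symm q.2.2) ((extChartAt (𝓡 d) p.2.2).symm z))) L q :=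
      HasFDerivAt.prodMap q (hasFDerivAt_id q.1) (HasFDerivAt.prodMap q.2 (hasFDerivAt_id q.2.1) h2)
    have h5 : writtenInExtChartAt 𝓘(ℝ, ℝ × ℝ × EuclideanSpace ℝ (Fin d)) (model d) q
        (Prod.map id (Prod.map id (extChartAt (𝓡 d) p.2.2).symm)) =
        Prod.map id (Prod.map id fun z => extChartAt (𝓡 d)
        ((extChartAt (𝓡 d) p.2.2).symm q.2.2) ((extChartAt (𝓡 d) p.2.2).symm z)) := by
      rw [writtenInExtChartAt, extChartAt_model]; rfl
    rw [← h5] at h4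
    exact ⟨continuousAt_id.prodMap (continuousAt_id.prodMap h1.1), h4.hasFDerivWithinAt⟩
  rw [← extChartAt_model_symm] at h3
  exact congrArg (fun l : ℝ × ℝ × EuclideanSpace ℝ (Fin d) →L[ℝ]
    ℝ × ℝ × EuclideanSpace ℝ (Fin d) => l X) h3.mfderiv

theorem components_model (p : ℝ × ℝ × S) {q : ℝ × ℝ × EuclideanSpace ℝ (Fin d)}
    (hq : q.2.2 ∈ (extChartAt (𝓡 d) p.2.2).target) (a b : ℝ)
    (Z : TangentSpace (𝓡 d) ((extChartAt (model d) p).symm q).2.2) :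
    components (model d) p ((extChartAt (model d) p).symm q) (mkTangent _ a b Z)
      = (a, b, components (𝓡 d) p.2.2 ((extChartAt (𝓡 d) p.2.2).symm q.2.2)
          (show EuclideanSpace ℝ (Fin d) from Z)) := by
  have h := ofComponents_model p hq (a, b, components (𝓡 d) p.2.2
    ((extChartAt (𝓡 d) p.2.2).symm q.2.2) (show EuclideanSpace ℝ (Fin d) from Z))
  refine Eq.trans (congrArg (components (model d) p _) ?_)
    (components_ofComponents (model d) (mem_extChartAt_model_target.2 hq) _)
  exact (h.trans (congrArg
    (fun W : EuclideanSpace ℝ (Fin d) => ((a, b, W) : ℝ × ℝ × EuclideanSpace ℝ (Fin d)))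
    (ofComponents_components (𝓡 d) hq Z))).symm

theorem Data.localMetric_metric (D : Data d S) (p : ℝ × ℝ × S)
    {q : ℝ × ℝ × EuclideanSpace ℝ (Fin d)} (hq : q.2.2 ∈ (extChartAt (𝓡 d) p.2.2).target)
    (X Y : ℝ × ℝ × EuclideanSpace ℝ (Fin d)) :
    localMetric (model d) D.metric p q X Y
      = nearHorizonForm (localForm D.γ p.2.2) (localCovector D.s p.2.2) (localFun D.h p.2.2)
          q X Y := by
  have hX := ofComponents_model p hq X
  have hY := ofComponents_model p hq Y
  rw [localMetric, hX, hY, extChartAt_model_symm]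
  rfl

theorem Data.localField_zeta (D : Data d S) (f : S → ℝ) (p : ℝ × ℝ × S)
    {q : ℝ × ℝ × EuclideanSpace ℝ (Fin d)} (hq : q.2.2 ∈ (extChartAt (𝓡 d) p.2.2).target) :
    localField (model d) (D.zeta f) p q
      = nearHorizonField (localFun f p.2.2) (localFun (laplacian D.γ f) p.2.2)
          (localField (𝓡 d) (grad D.γ f) p.2.2) q := by
  rw [localField, Data.zeta, components_model p hq]
  rw [extChartAt_model_symm]
  simp only [nearHorizonField, localField, localFun, components]
  refine Prod.ext rfl (Prod.ext rfl ?_)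
  exact map_smul _ _ _

/-- `D_A D_B f = s_A ∂_B f + s_B ∂_A f`. -/
def Data.HessianEq (D : Data d S) (f : S → ℝ) (x : S) : Prop :=
  ∀ v w : EuclideanSpace ℝ (Fin d), hessian D.γ f x v w
    = diff (𝓡 d) f x v * D.s x w + diff (𝓡 d) f x w * D.s x v

/-- The `dv`-cut components of the Killing equation. -/
def Data.MixedEq (D : Data d S) (f : S → ℝ) (x : S) : Prop :=
  ∀ w : EuclideanSpace ℝ (Fin d),
    mixedForm (localCovector D.s x) (localFun D.h x) (localFun f x)
      (localFun (laplacian D.γ f) x) (localField (𝓡 d) (grad D.γ f) x) (extChartAt (𝓡 d) x x) w = 0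

/-- Near `p` the local representatives of metric and field are `nearHorizonForm` and
`nearHorizonField`, so this is `lie_nearHorizonForm` with the Lie derivative of `γ` along `grad f`
replaced by twice the Hessian. -/
theorem Data.lieDerivMetric_zeta (D : Data d S) {f : S → ℝ}
    (hf : ContMDiff (𝓡 d) 𝓘(ℝ, ℝ) ∞ f) (p : ℝ × ℝ × S)
    (hΦ : DifferentiableAt ℝ (localFun (laplacian D.γ f) p.2.2) (extChartAt (𝓡 d) p.2.2 p.2.2))
    (X Y : ℝ × ℝ × EuclideanSpace ℝ (Fin d)) :
    lieDerivMetric (model d) D.metric (D.zeta f) p X Y =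
      p.2.1 * (laplacian D.γ f p.2.2 - 2 * D.s p.2.2 (grad D.γ f p.2.2))
          * (X.1 * Y.2.1 + Y.1 * X.2.1)
        + p.2.1 ^ 2 * (X.1 * mixedForm (localCovector D.s p.2.2) (localFun D.h p.2.2)
              (localFun f p.2.2) (localFun (laplacian D.γ f) p.2.2)
              (localField (𝓡 d) (grad D.γ f) p.2.2) (extChartAt (𝓡 d) p.2.2 p.2.2) Y.2.2
            + Y.1 * mixedForm (localCovector D.s p.2.2) (localFun D.h p.2.2)
              (localFun f p.2.2) (localFun (laplacian D.γ f) p.2.2)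
              (localField (𝓡 d) (grad D.γ f) p.2.2) (extChartAt (𝓡 d) p.2.2 p.2.2) X.2.2)
        + p.2.1 ^ 3 * (laplacian D.γ f p.2.2 * D.h p.2.2
            - diff (𝓡 d) D.h p.2.2 (grad D.γ f p.2.2)) * (X.1 * Y.1)
        + 2 * p.2.1 * (diff (𝓡 d) f p.2.2 X.2.2 * D.s p.2.2 Y.2.2
            + diff (𝓡 d) f p.2.2 Y.2.2 * D.s p.2.2 X.2.2
            - hessian D.γ f p.2.2 X.2.2 Y.2.2) := by
  have hq := extChartAt_model_self_eventually (d := d) p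
  have hp : extChartAt (model d) p p = (p.1, p.2.1, extChartAt (𝓡 d) p.2.2 p.2.2) :=
    extChartAt_model_apply p p
  have hm : (fun q => localMetric (model d) D.metric p q X Y) =ᶠ[𝓝 (extChartAt (model d) p p)]
      fun q => nearHorizonForm (localForm D.γ p.2.2) (localCovector D.s p.2.2)
        (localFun D.h p.2.2) q X Y := hq.mono fun q h => D.localMetric_metric p h X Y
  have hz : localField (model d) (D.zeta f) p =ᶠ[𝓝 (extChartAt (model d) p p)]
      nearHorizonField (localFun f p.2.2) (localFun (laplacian D.γ f) p.2.2)
        (localField (𝓡 d) (grad D.γ f) p.2.2) := hq.mono fun q h => D.localField_zeta f p h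
  rw [lieDerivMetric, hm.fderiv_eq, hz.fderiv_eq, hz.self_of_nhds,
    D.localMetric_metric p hq.self_of_nhds, D.localMetric_metric p hq.self_of_nhds, hp]
  have key := lie_nearHorizonForm (p := (p.1, p.2.1, extChartAt (𝓡 d) p.2.2 p.2.2))
    (differentiableAt_localForm D.γ p.2.2)
    ((D.contDiffAt_localCovector p.2.2).differentiableAt (by simp))
    (differentiableAt_localFun D.smooth_h p.2.2) (differentiableAt_localFun hf p.2.2) hΦ
    (differentiableAt_localField_grad D.γ hf p.2.2) (fun v w => localForm_symm D.γ p.2.2 _ v w)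
    (eventually_localForm_grad D.γ hf p.2.2).self_of_nhds X Y
  rw [key, lieForm_grad (Filter.Eventually.of_forall fun z v w => localForm_symm D.γ p.2.2 z v w)
    (eventually_localForm_grad D.γ hf p.2.2) (differentiableAt_localForm D.γ p.2.2)
    (differentiableAt_localField_grad D.γ hf p.2.2) (contDiffAt_localFun hf.contMDiffAt),
    ← hessian_eq_hessForm D.γ p.2.2 _ _ hf]
  simp only [localFun_self, localField_self, localCovector_self, ← diff_apply hf]
  have e1 := diff_apply D.smooth_h p.2.2 (grad D.γ f p.2.2)
  have e2 := localCovector_self D.s p.2.2 (grad D.γ f p.2.2)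
  rw [e1]
  erw [e2]
  ring

end Spacetime

/-! ### The Killing equation of `ζ` as equations on the cut -/

section KillingEquations

variable {d : ℕ} {S : Type*} [TopologicalSpace S] [ChartedSpace (EuclideanSpace ℝ (Fin d)) S]

theorem diff_comp {a : S → ℝ} (ha : ContMDiff (𝓡 d) 𝓘(ℝ, ℝ) ∞ a) {P : ℝ → ℝ} (x : S)
    (hP : DifferentiableAt ℝ P (a x)) (v : TangentSpace (𝓡 d) x) :
    diff (𝓡 d) (fun y => P (a y)) x v = deriv P (a x) * diff (𝓡 d) a x v := by
  have ha' : MDifferentiableAt (𝓡 d) 𝓘(ℝ, ℝ) a x := ha.mdifferentiable (by simp) x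
  have h := hP.hasDerivAt.hasFDerivAt.hasMFDerivAt.comp x ha'.hasMFDerivAt
  refine (congrArg (fun l : EuclideanSpace ℝ (Fin d) →L[ℝ] ℝ => l v) h.mfderiv).trans ?_
  exact mul_comm _ _

variable [IsManifold (𝓡 d) ∞ S]

theorem diff_mul {a b : S → ℝ} (ha : ContMDiff (𝓡 d) 𝓘(ℝ, ℝ) ∞ a)
    (hb : ContMDiff (𝓡 d) 𝓘(ℝ, ℝ) ∞ b) (x : S) (v : TangentSpace (𝓡 d) x) :
    diff (𝓡 d) (fun y => a y * b y) x v = a x * diff (𝓡 d) b x v + b x * diff (𝓡 d) a x v := by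
  have h := ((differentiableAt_localFun ha x).hasFDerivAt.mul
    (differentiableAt_localFun hb x).hasFDerivAt).fderiv
  have h1 := diff_apply (ha.mul hb) x v
  have h2 := diff_apply ha x v
  have h3 := diff_apply hb x v
  rw [h2, h3]
  refine h1.trans ?_
  refine (congrArg (fun l : EuclideanSpace ℝ (Fin d) →L[ℝ] ℝ => l v) h).trans ?_
  simp only [localFun_self]
  rfl

variable (D : Data d S) {f : S → ℝ}

/-- `laplacian` uses a different chart at every point, so its smoothness is not visible from the
definition. It is read off from the `∂_u` component `(u²/2) Δf` of a smooth `ζ` at some `u ≠ 0`. -/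
theorem Data.contMDiffAt_laplacian {v u : ℝ} {x : S}
    (hu : u ≠ 0)
    (hζ : ContMDiffAt (model d) (model d).tangent ∞
      (fun q => (⟨q, D.zeta f q⟩ : TangentBundle (model d) (ℝ × ℝ × S))) (v, u, x)) :
    ContMDiffAt (𝓡 d) 𝓘(ℝ, ℝ) ∞ (laplacian D.γ f) x := by
  rw [contMDiffAt_iff_contDiffAt_localField, extChartAt_model_apply] at hζ
  have hq := extChartAt_model_self_eventually (d := d) (v, u, x)
  rw [extChartAt_model_apply] at hq
  have h1 := hζ.congr_of_eventuallyEq (hq.mono fun q h => (D.localField_zeta f (v, u, x) h).symm)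
  have h2 : ContDiffAt ℝ ∞ (fun y : EuclideanSpace ℝ (Fin d) => ((v, u, y) : ℝ × ℝ × _))
      (extChartAt (𝓡 d) x x) := contDiffAt_const.prodMk (contDiffAt_const.prodMk contDiffAt_id)
  have h3 := (h1.comp (extChartAt (𝓡 d) x x) h2).snd.fst
  have h4 := h3.const_smul (u ^ 2 / 2)⁻¹
  rw [contMDiffAt_iff_contDiffAt_comp_symm]
  refine h4.congr_of_eventuallyEq (Filter.Eventually.of_forall fun y => ?_)
  simp only [nearHorizonField, Function.comp_apply, smul_eq_mul, localFun]
  field_simp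

theorem Data.contMDiff_zeta (hf : ContMDiff (𝓡 d) 𝓘(ℝ, ℝ) ∞ f)
    (hΦ : ContMDiff (𝓡 d) 𝓘(ℝ, ℝ) ∞ (laplacian D.γ f)) :
    ContMDiff (model d) (model d).tangent ∞
      (fun q => (⟨q, D.zeta f q⟩ : TangentBundle (model d) (ℝ × ℝ × S))) := by
  intro p
  rw [contMDiffAt_iff_contDiffAt_localField, extChartAt_model_apply]
  have hq := extChartAt_model_self_eventually (d := d) p
  rw [extChartAt_model_apply] at hq
  refine ContDiffAt.congr_of_eventuallyEq ?_ (hq.mono fun q h => D.localField_zeta f p h)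
  have hu : ContDiff ℝ ∞ (fun q : ℝ × ℝ × EuclideanSpace ℝ (Fin d) => q.2.1) :=
    contDiff_snd.fst
  have hy : ContDiff ℝ ∞ (fun q : ℝ × ℝ × EuclideanSpace ℝ (Fin d) => q.2.2) :=
    contDiff_snd.snd
  have h1 := (contDiffAt_localFun hf.contMDiffAt (x := p.2.2)).comp
    (p.1, p.2.1, extChartAt (𝓡 d) p.2.2 p.2.2) hy.contDiffAt
  have h2 := (contDiffAt_localFun hΦ.contMDiffAt (x := p.2.2)).comp
    (p.1, p.2.1, extChartAt (𝓡 d) p.2.2 p.2.2) hy.contDiffAt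
  have h3 := (contDiffAt_localField_grad D.γ hf p.2.2).comp
    (p.1, p.2.1, extChartAt (𝓡 d) p.2.2 p.2.2) hy.contDiffAt
  exact h1.prodMk ((((hu.pow 2).div_const 2).contDiffAt.mul h2).prodMk
    (hu.neg.contDiffAt.smul h3))

/-- The Killing equation is void at `u = 0`; information on the cut comes from nearby points off the
horizon. -/
theorem exists_ne_zero_mem_of_isOpen {U : Set (ℝ × ℝ × S)} (hU : IsOpen U) {v : ℝ} {x : S}
    (h : (v, (0 : ℝ), x) ∈ U) : ∃ u : ℝ, u ≠ 0 ∧ (v, u, x) ∈ U := by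
  have h1 : ∀ᶠ u in 𝓝 (0 : ℝ), (v, u, x) ∈ U := by
    have hc : Continuous fun u : ℝ => ((v, u, x) : ℝ × ℝ × S) := by fun_prop
    exact hc.continuousAt.preimage_mem_nhds (hU.mem_nhds h)
  have h2 : ∀ᶠ u in 𝓝[≠] (0 : ℝ), u ≠ 0 ∧ (v, u, x) ∈ U :=
    eventually_mem_nhdsWithin.and (h1.filter_mono nhdsWithin_le_nhds)
  exact h2.exists

theorem Data.laplacian_of_hessianEq {x : S} (h : D.HessianEq f x) :
    laplacian D.γ f x = 2 * D.s x (grad D.γ f x) :=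
  laplacian_of_hessian_eq D.γ x (D.s x) h

/-- At a point with `u ≠ 0` suitable pairs of vectors isolate the coefficients of the polynomial in
`Data.lieDerivMetric_zeta`. Conversely all its coefficients vanish, the `dv du` one because the
trace of the Hessian equation is `Δf = 2 s(grad f)`. -/
theorem Data.isKillingOn_zeta_iff (hf : ContMDiff (𝓡 d) 𝓘(ℝ, ℝ) ∞ f)
    {U : Set (ℝ × ℝ × S)} (hU : IsOpen U) (hU₀ : ∀ x : S, ∃ v : ℝ, (v, (0 : ℝ), x) ∈ U) :
    IsKillingOn (model d) D.metric U (D.zeta f) ↔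
      ContMDiff (𝓡 d) 𝓘(ℝ, ℝ) ∞ (laplacian D.γ f) ∧
        ∀ x, D.HessianEq f x ∧ D.MixedEq f x ∧
          diff (𝓡 d) D.h x (grad D.γ f x) = laplacian D.γ f x * D.h x := by
  constructor
  · rintro ⟨hζ, hL⟩
    have hΦ : ContMDiff (𝓡 d) 𝓘(ℝ, ℝ) ∞ (laplacian D.γ f) := by
      intro x
      obtain ⟨v, hv⟩ := hU₀ x
      obtain ⟨u, hu, hvu⟩ := exists_ne_zero_mem_of_isOpen hU hv
      exact D.contMDiffAt_laplacian hu ((hζ _ hvu).contMDiffAt (hU.mem_nhds hvu))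
    refine ⟨hΦ, fun x => ?_⟩
    obtain ⟨v, hv⟩ := hU₀ x
    obtain ⟨u, hu, hvu⟩ := exists_ne_zero_mem_of_isOpen hU hv
    have key : ∀ X Y : ℝ × ℝ × EuclideanSpace ℝ (Fin d), _ = (0 : ℝ) := fun X Y =>
      (D.lieDerivMetric_zeta hf (v, u, x) (differentiableAt_localFun hΦ x) X Y).symm.trans
        (hL (v, u, x) hvu X Y)
    have hH : D.HessianEq f x := by
      intro a b
      -- Vectors tangent to the cut leave only the Hessian term.
      have h := key (0, 0, a) (0, 0, b)
      simp [hu] at h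
      linarith
    refine ⟨hH, fun w => ?_, ?_⟩
    · have h := key (1, 0, 0) (0, 0, w)
      -- The Hessian term at the zero vector is removed by the Hessian equation just obtained.
      have h' := hH 0 w
      dsimp only at h
      refine (mul_eq_zero.1 ?_).resolve_left (pow_ne_zero 2 hu)
      linear_combination h + 2 * u * h'
    · have h := key (1, 0, 0) (1, 0, 0)
      have h' := hH 0 0
      have e1 : ∀ σ h F Φ G y, mixedForm σ h F Φ G y (0 : EuclideanSpace ℝ (Fin d)) = 0 := by
        intro σ h F Φ G y; simp [mixedForm]
      dsimp only at h
      rw [e1] at h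
      have h3 := (mul_eq_zero.1 (show u ^ 3 * (laplacian D.γ f x * D.h x
        - diff (𝓡 d) D.h x (grad D.γ f x)) = 0 by linear_combination h + 2 * u * h')).resolve_left
          (pow_ne_zero 3 hu)
      linarith
  · rintro ⟨hΦ, h⟩
    refine ⟨(D.contMDiff_zeta hf hΦ).contMDiffOn, fun p _ X Y => ?_⟩
    obtain ⟨h1, h2, h3⟩ := h p.2.2
    rw [D.lieDerivMetric_zeta hf p (differentiableAt_localFun hΦ p.2.2),
      D.laplacian_of_hessianEq h1, h1 X.2.2 Y.2.2, h2 X.2.2, h2 Y.2.2, h3,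
      D.laplacian_of_hessianEq h1]
    ring

/-- Insert `grad f` into one slot of the Hessian equation. Where `N = 0` this feeds unique
continuation; where `N ≠ 0` it can be solved for `s`. -/
theorem Data.diff_normSq_of_hessianEq (hf : ContMDiff (𝓡 d) 𝓘(ℝ, ℝ) ∞ f) {x : S}
    (h : D.HessianEq f x) (w : EuclideanSpace ℝ (Fin d)) :
    diff (𝓡 d) (normSq D.γ f) x w
      = laplacian D.γ f x * diff (𝓡 d) f x w + 2 * normSq D.γ f x * D.s x w := by
  refine (diff_normSq D.γ hf x w).trans ?_
  refine (congrArg (2 * ·) (h w (grad D.γ f x))).trans ?_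
  rw [D.laplacian_of_hessianEq h, normSq_eq_diff]
  ring

theorem Data.s_eq_of_hessianEq (hf : ContMDiff (𝓡 d) 𝓘(ℝ, ℝ) ∞ f) {x : S}
    (h : D.HessianEq f x) (hN : normSq D.γ f x ≠ 0) :
    D.s x = (1 / 2 : ℝ) • ((normSq D.γ f x)⁻¹ • diff (𝓡 d) (normSq D.γ f) x
      - (laplacian D.γ f x / normSq D.γ f x) • diff (𝓡 d) f x) := by
  refine ContinuousLinearMap.ext fun w => ?_
  have h1 := D.diff_normSq_of_hessianEq hf h w
  simp only [smul_apply, sub_apply, smul_eq_mul]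
  refine Eq.symm ((congrArg (fun t : ℝ => 1 / 2 * ((normSq D.γ f x)⁻¹ * t
    - laplacian D.γ f x / normSq D.γ f x * diff (𝓡 d) f x w)) h1).trans ?_)
  field_simp
  ring

/-- The local form of `s = ½ (dN/N - p df)`. -/
theorem Data.localCovector_s_eventually (hf : ContMDiff (𝓡 d) 𝓘(ℝ, ℝ) ∞ f) {p : S → ℝ}
    (hs : ∀ x, D.s x = (1 / 2 : ℝ) • ((normSq D.γ f x)⁻¹ • diff (𝓡 d) (normSq D.γ f) x
      - p x • diff (𝓡 d) f x)) (x : S) :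
    ∀ᶠ y in 𝓝 (extChartAt (𝓡 d) x x), localCovector D.s x y = (1 / 2 : ℝ) •
      ((localFun (normSq D.γ f) x y)⁻¹ • fderiv ℝ (localFun (normSq D.γ f) x) y
        - localFun p x y • fderiv ℝ (localFun f x) y) := by
  filter_upwards [eventually_localCovector_diff (contMDiff_normSq D.γ hf) x,
    eventually_localCovector_diff hf x] with y h1 h2
  rw [← h1, ← h2]
  ext w
  simp only [localCovector_apply, localOneForm, hs]
  rfl

theorem Data.extDeriv_s (hf : ContMDiff (𝓡 d) 𝓘(ℝ, ℝ) ∞ f) {p : S → ℝ}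
    (hp : ContMDiff (𝓡 d) 𝓘(ℝ, ℝ) ∞ p) (hN : ∀ x, normSq D.γ f x ≠ 0)
    (hs : ∀ x, D.s x = (1 / 2 : ℝ) • ((normSq D.γ f x)⁻¹ • diff (𝓡 d) (normSq D.γ f) x
      - p x • diff (𝓡 d) f x)) (x : S) (v w : EuclideanSpace ℝ (Fin d)) :
    fderiv ℝ (localCovector D.s x) (extChartAt (𝓡 d) x x) v w
        - fderiv ℝ (localCovector D.s x) (extChartAt (𝓡 d) x x) w v
      = -(1 / 2) * (diff (𝓡 d) p x v * diff (𝓡 d) f x w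
          - diff (𝓡 d) p x w * diff (𝓡 d) f x v) := by
  rw [fderiv_skew_of_eventuallyEq (contDiffAt_localFun (contMDiff_normSq D.γ hf).contMDiffAt)
    (by rw [localFun_self]; exact hN x) (differentiableAt_localFun hp x)
    (contDiffAt_localFun hf.contMDiffAt) (D.localCovector_s_eventually hf hs x),
    ← diff_apply hf, ← diff_apply hf, ← diff_apply hp, ← diff_apply hp]

/-- By Cartan's formula the Lie derivative of `s` along `grad f` is `d(s(grad f)) + ds(grad f, ·)`.
Here `s(grad f) = ½ Δf`, and `ds = -½ dp ∧ df`, so everything reduces to `df` and `dp`. -/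
theorem Data.mixedForm_eq (hf : ContMDiff (𝓡 d) 𝓘(ℝ, ℝ) ∞ f) {p : S → ℝ}
    (hp : ContMDiff (𝓡 d) 𝓘(ℝ, ℝ) ∞ p) (hN : ∀ x, normSq D.γ f x ≠ 0)
    (hH : ∀ x, D.HessianEq f x) (hΦ : ∀ x, laplacian D.γ f x = p x * normSq D.γ f x)
    (x : S) (w : EuclideanSpace ℝ (Fin d)) :
    mixedForm (localCovector D.s x) (localFun D.h x) (localFun f x)
      (localFun (laplacian D.γ f) x) (localField (𝓡 d) (grad D.γ f) x) (extChartAt (𝓡 d) x x) w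
      = (D.h x - 1 / 2 * p x ^ 2 * normSq D.γ f x + diff (𝓡 d) p x (grad D.γ f x))
          * diff (𝓡 d) f x w - 3 / 2 * normSq D.γ f x * diff (𝓡 d) p x w := by
  have hNs := contMDiff_normSq D.γ hf
  have hs : ∀ x, D.s x = (1 / 2 : ℝ) • ((normSq D.γ f x)⁻¹ • diff (𝓡 d) (normSq D.γ f) x
      - p x • diff (𝓡 d) f x) := by
    intro x
    rw [D.s_eq_of_hessianEq hf (hH x) (hN x), hΦ, mul_div_cancel_right₀ _ (hN x)]
  have hΦs : ContMDiff (𝓡 d) 𝓘(ℝ, ℝ) ∞ (laplacian D.γ f) := by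
    rw [show laplacian D.γ f = fun x => p x * normSq D.γ f x from funext hΦ]
    exact hp.mul hNs
  have hσd : DifferentiableAt ℝ (localCovector D.s x) (extChartAt (𝓡 d) x x) :=
    (D.contDiffAt_localCovector x).differentiableAt (by simp)
  have hGd := differentiableAt_localField_grad D.γ hf x
  have h1 : localFun (laplacian D.γ f) x =ᶠ[𝓝 (extChartAt (𝓡 d) x x)]
      fun y => 2 * localCovector D.s x y (localField (𝓡 d) (grad D.γ f) x y) := by
    filter_upwards [extChartAt_target_mem_nhds x] with y hy
    rw [← localFun_eq_diff_grad (grad D.γ f) hy]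
    exact D.laplacian_of_hessianEq (hH _)
  have h2 : fderiv ℝ (localFun (laplacian D.γ f) x) (extChartAt (𝓡 d) x x) w =
      2 * (fderiv ℝ (localCovector D.s x) (extChartAt (𝓡 d) x x) w
          (localField (𝓡 d) (grad D.γ f) x (extChartAt (𝓡 d) x x))
        + localCovector D.s x (extChartAt (𝓡 d) x x)
          (fderiv ℝ (localField (𝓡 d) (grad D.γ f) x) (extChartAt (𝓡 d) x x) w)) := by
    rw [h1.fderiv_eq, ((hσd.hasFDerivAt.clm_apply hGd.hasFDerivAt).const_mul 2).fderiv]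
    simp
    ring
  have h3 := D.extDeriv_s hf hp hN hs x
    (localField (𝓡 d) (grad D.γ f) x (extChartAt (𝓡 d) x x)) w
  have h4 : diff (𝓡 d) (laplacian D.γ f) x w = p x * diff (𝓡 d) (normSq D.γ f) x w
      + normSq D.γ f x * diff (𝓡 d) p x w := by
    rw [show laplacian D.γ f = fun x => p x * normSq D.γ f x from funext hΦ]
    exact diff_mul hp hNs x w
  have h5 := D.diff_normSq_of_hessianEq hf (hH x) w
  have h6 : diff (𝓡 d) (laplacian D.γ f) x w = _ := diff_apply hΦs x w
  have h7 : diff (𝓡 d) f x (grad D.γ f x) = normSq D.γ f x := (normSq_eq_diff D.γ f x).symm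
  rw [mixedForm, localFun_self, localFun_self, localCovector_self, ← diff_apply hf]
  rw [← h6] at h2 ⊢
  rw [localField_self] at h2 h3 ⊢
  rw [h7] at h3
  rw [hΦ] at h5 ⊢
  -- Cartan's formula is `h2` with `h3`; `h4` expands `d(pN)`, and `h5` eliminates `dN` in favour of
  -- `s`.
  linear_combination h2 - 2 * h3 - 1 / 2 * h4 - p x / 2 * h5

end KillingEquations

/-! ### Unique continuation and the absence of critical points -/

section UniqueContinuation

/-- Grönwall's inequality along the segments from `y` to the points of a small ball. -/
theorem eventually_eq_zero_of_norm_fderiv_le {E V : Type*} [NormedAddCommGroup E]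
    [NormedSpace ℝ E] [NormedAddCommGroup V] [NormedSpace ℝ V] {α : E → V} {y : E} {K : E → ℝ}
    (hK : ContinuousAt K y) (hα : ∀ᶠ z in 𝓝 y, DifferentiableAt ℝ α z)
    (hb : ∀ᶠ z in 𝓝 y, ‖fderiv ℝ α z‖ ≤ K z * ‖α z‖) (h0 : α y = 0) :
    ∀ᶠ z in 𝓝 y, α z = 0 := by
  -- Continuity of `K` at `y` supplies one Grönwall constant, `K y + 1`, for the whole ball.
  have hK' : ∀ᶠ z in 𝓝 y, K z < K y + 1 := hK.eventually_lt continuousAt_const (by simp)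
  obtain ⟨ε, hε, hball⟩ := Metric.eventually_nhds_iff_ball.1 ((hα.and hb).and hK')
  refine Metric.eventually_nhds_iff_ball.2 ⟨ε, hε, fun z hz => ?_⟩
  let c : ℝ → E := fun t => y + t • (z - y)
  have hc : ∀ t ∈ Icc (0 : ℝ) 1, c t ∈ Metric.ball y ε := by
    intro t ht
    rw [Metric.mem_ball, dist_eq_norm] at hz ⊢
    simp only [c, add_sub_cancel_left, norm_smul, Real.norm_eq_abs, abs_of_nonneg ht.1]
    exact lt_of_le_of_lt (mul_le_of_le_one_left (norm_nonneg _) ht.2) hz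
  have hcd : ∀ t, HasDerivAt c (z - y) t := by
    intro t
    simpa [c] using ((hasDerivAt_id t).smul_const (z - y)).const_add y
  have hd : ∀ t ∈ Icc (0 : ℝ) 1, HasDerivAt (fun t => α (c t)) (fderiv ℝ α (c t) (z - y)) t :=
    fun t ht => (hball _ (hc t ht)).1.1.hasFDerivAt.comp_hasDerivAt t (hcd t)
  have key := eq_zero_of_abs_deriv_le_mul_abs_self_of_eq_zero_right
    (f := fun t => α (c t)) (f' := fun t => fderiv ℝ α (c t) (z - y))
    (K := (K y + 1) * ‖z - y‖) (a := 0) (b := 1)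
    (fun t ht => (hd t ht).continuousAt.continuousWithinAt)
    (fun t ht => (hd t (Ico_subset_Icc_self ht)).hasDerivWithinAt) (by simp [c, h0])
    (fun t ht => by
      obtain ⟨⟨-, h1⟩, h2⟩ := hball _ (hc t (Ico_subset_Icc_self ht))
      calc ‖fderiv ℝ α (c t) (z - y)‖ ≤ ‖fderiv ℝ α (c t)‖ * ‖z - y‖ :=
            ContinuousLinearMap.le_opNorm _ _
        _ ≤ ((K y + 1) * ‖α (c t)‖) * ‖z - y‖ := by
            gcongr
            exact h1.trans (by gcongr)
        _ = (K y + 1) * ‖z - y‖ * ‖α (c t)‖ := by ring)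
    1 (by simp)
  simpa [c] using key

/-- The zero set is closed by continuity and open by the local statement. The bound may depend on
the chart, so no global norm is needed. -/
theorem eq_zero_of_norm_fderiv_le {E : Type*} [NormedAddCommGroup E] [NormedSpace ℝ E]
    {H : Type*} [TopologicalSpace H] (I : ModelWithCorners ℝ E H) [I.Boundaryless]
    {M : Type*} [TopologicalSpace M] [ChartedSpace H M] [PreconnectedSpace M]
    {V : Type*} [NormedAddCommGroup V] [NormedSpace ℝ V] {α : M → V} (hα : Continuous α)
    (h : ∀ x, ∃ K : E → ℝ, ContinuousAt K (extChartAt I x x) ∧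
      ∀ᶠ y in 𝓝 (extChartAt I x x),
        DifferentiableAt ℝ (fun z => α ((extChartAt I x).symm z)) y ∧
        ‖fderiv ℝ (fun z => α ((extChartAt I x).symm z)) y‖
          ≤ K y * ‖α ((extChartAt I x).symm y)‖)
    {x₀ : M} (h₀ : α x₀ = 0) (x : M) : α x = 0 := by
  have hclopen : IsClopen {x | α x = 0} := by
    refine ⟨isClosed_eq hα continuous_const, isOpen_iff_mem_nhds.2 fun x hx => ?_⟩
    obtain ⟨K, hK, hb⟩ := h x
    have h1 := eventually_eq_zero_of_norm_fderiv_le hK (hb.mono fun y hy => hy.1)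
      (hb.mono fun y hy => hy.2) (by rw [extChartAt_to_inv]; exact hx)
    filter_upwards [(continuousAt_extChartAt (I := I) x).eventually h1,
      extChartAt_source_mem_nhds (I := I) x] with q hq hqs
    rwa [(extChartAt I x).left_inv hqs] at hq
  have := hclopen.eq_univ ⟨x₀, h₀⟩
  exact this.ge (mem_univ x)

theorem continuousAt_sqrt_norm {X V : Type*} [TopologicalSpace X] [SeminormedAddCommGroup V]
    {g : X → V} {y : X} (h : ContinuousAt g y) : ContinuousAt (fun z => √‖g z‖) y :=
  h.norm.sqrt

theorem sqrt_bilin_le {E : Type*} [NormedAddCommGroup E] [NormedSpace ℝ E]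
    (B : E →L[ℝ] E →L[ℝ] ℝ) (w : E) : √(B w w) ≤ √‖B‖ * ‖w‖ := by
  have h : B w w ≤ ‖B‖ * ‖w‖ ^ 2 := by
    rw [pow_two, ← mul_assoc]
    exact (le_abs_self _).trans (B.le_opNorm₂ w w)
  exact (Real.sqrt_le_sqrt h).trans
    (le_of_eq (by rw [Real.sqrt_mul (ContinuousLinearMap.opNorm_nonneg B), Real.sqrt_sq (norm_nonneg w)]))

variable {d : ℕ} {S : Type*} [TopologicalSpace S] [ChartedSpace (EuclideanSpace ℝ (Fin d)) S]
  [IsManifold (𝓡 d) ∞ S]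

/-- Cauchy–Schwarz, from the nonnegative square of `γ(Y,Y) X - γ(X,Y) Y`. -/
theorem form_mul_form_le (γ : RiemMetric d S) (x : S) (X Y : TangentSpace (𝓡 d) x) :
    γ.form x X Y ^ 2 ≤ γ.form x X X * γ.form x Y Y := by
  by_cases hY : Y = 0
  · rw [hY]; simp [RiemMetric.form]
  have hYY : 0 < γ.form x Y Y := γ.pos x Y hY
  have h := form_self_nonneg γ x (γ.form x Y Y • X - γ.form x X Y • Y)
  have h' : γ.form x (γ.form x Y Y • X - γ.form x X Y • Y) (γ.form x Y Y • X - γ.form x X Y • Y)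
      = γ.form x Y Y * (γ.form x X X * γ.form x Y Y - γ.form x X Y ^ 2) := by
    have hs := form_symm γ x Y X
    simp only [RiemMetric.form, map_sub, map_smul, sub_apply, smul_apply, smul_eq_mul] at hs ⊢
    rw [hs]; ring
  rw [h'] at h
  have := nonneg_of_mul_nonneg_right h hYY
  linarith

/-- In `dN = 2 s(grad f) df + 2 N s` the factors `s(grad f)` and `df` are each bounded by a multiple
of `√N`, so both terms are linear in `N`. -/
theorem Data.abs_diff_normSq_le (D : Data d S) {f : S → ℝ} (hf : ContMDiff (𝓡 d) 𝓘(ℝ, ℝ) ∞ f)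
    {x : S} (h : D.HessianEq f x) (W : TangentSpace (𝓡 d) x) :
    |diff (𝓡 d) (normSq D.γ f) x W| ≤
      (2 * √(D.γ.form x (sharp D.γ x (D.s x)) (sharp D.γ x (D.s x))) * √(D.γ.form x W W)
        + 2 * |D.s x W|) * normSq D.γ f x := by
  have h1 : diff (𝓡 d) (normSq D.γ f) x W = _ := D.diff_normSq_of_hessianEq hf h W
  rw [D.laplacian_of_hessianEq h] at h1
  have hN := normSq_nonneg D.γ f x
  have e1 : |D.s x (grad D.γ f x)|
      ≤ √(D.γ.form x (sharp D.γ x (D.s x)) (sharp D.γ x (D.s x))) * √(normSq D.γ f x) := by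
    rw [← Real.sqrt_mul (form_self_nonneg D.γ x _)]
    refine Real.abs_le_sqrt ?_
    rw [← form_sharp D.γ x (D.s x) (grad D.γ f x)]
    exact form_mul_form_le D.γ x _ _
  have e2 : |diff (𝓡 d) f x W| ≤ √(normSq D.γ f x) * √(D.γ.form x W W) := by
    rw [← Real.sqrt_mul hN]
    refine Real.abs_le_sqrt ?_
    rw [← form_sharp D.γ x (diff (𝓡 d) f x) W]
    exact form_mul_form_le D.γ x _ _
  have e3 := mul_le_mul e1 e2 (abs_nonneg _) (by positivity)
  have e4 := Real.mul_self_sqrt hN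
  rw [h1]
  calc |2 * D.s x (grad D.γ f x) * diff (𝓡 d) f x W + 2 * normSq D.γ f x * D.s x W|
      ≤ 2 * (|D.s x (grad D.γ f x)| * |diff (𝓡 d) f x W|) + 2 * normSq D.γ f x * |D.s x W| := by
        refine (abs_add_le _ _).trans (le_of_eq ?_)
        simp only [abs_mul, abs_of_nonneg hN, abs_two]
        ring
    _ ≤ 2 * (√(D.γ.form x (sharp D.γ x (D.s x)) (sharp D.γ x (D.s x))) * √(normSq D.γ f x)
          * (√(normSq D.γ f x) * √(D.γ.form x W W))) + 2 * normSq D.γ f x * |D.s x W| := by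
        gcongr
    _ = _ := by
        linear_combination 2 * √(D.γ.form x (sharp D.γ x (D.s x)) (sharp D.γ x (D.s x)))
          * √(D.γ.form x W W) * e4

theorem eq_const_of_diff_eq_zero [PreconnectedSpace S] {f : S → ℝ}
    (hf : ContMDiff (𝓡 d) 𝓘(ℝ, ℝ) ∞ f) (h : ∀ x, diff (𝓡 d) f x = 0) (x₀ x : S) :
    f x = f x₀ := by
  have key := eq_zero_of_norm_fderiv_le (𝓡 d) (α := fun x => f x - f x₀)
    (hf.continuous.sub continuous_const) (fun x => ⟨fun _ => 0, continuousAt_const, ?_⟩)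
    (x₀ := x₀) (by simp) x
  · linarith
  · filter_upwards [extChartAt_target_mem_nhds (I := 𝓡 d) x] with y hy
    have hd : MDifferentiableAt (𝓡 d) 𝓘(ℝ, ℝ) f ((extChartAt (𝓡 d) x).symm y) :=
      hf.mdifferentiable (by simp) _
    constructor
    · have := hd.comp y (mdifferentiableAt_extChartAt_symm (𝓡 d) hy)
      exact (mdifferentiableAt_iff_differentiableAt.1 this).sub_const _
    · have h0 : fderiv ℝ (fun z => f ((extChartAt (𝓡 d) x).symm z)) y = 0 := by
        ext v
        rw [fderiv_comp_symm (𝓡 d) hy hd, h]; rfl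
      rw [fderiv_sub_const, h0]; simp

set_option synthInstance.maxHeartbeats 200000 in
-- One zero of `N` would make `N` vanish everywhere by unique continuation, and then `f` would be
-- constant.
theorem Data.diff_ne_zero_of_hessianEq [PreconnectedSpace S] (D : Data d S) {f : S → ℝ}
    (hf : ContMDiff (𝓡 d) 𝓘(ℝ, ℝ) ∞ f) (hf' : ¬ ∃ c : ℝ, ∀ x, f x = c)
    (h : ∀ x, D.HessianEq f x) (x : S) : diff (𝓡 d) f x ≠ 0 := by
  intro hx
  apply hf'
  refine ⟨f x, eq_const_of_diff_eq_zero hf (fun z => ?_) x⟩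
  rw [← normSq_eq_zero_iff D.γ] at hx ⊢
  have hN := contMDiff_normSq D.γ hf
  refine eq_zero_of_norm_fderiv_le (𝓡 d) hN.continuous (fun x => ?_) hx z
  let X : EuclideanSpace ℝ (Fin d) → EuclideanSpace ℝ (Fin d) :=
    localField (𝓡 d) (fun q => sharp D.γ q (D.s q)) x
  have hX : ContDiffAt ℝ ∞ X (extChartAt (𝓡 d) x x) :=
    contDiffAt_localField_sharp D.γ D.s (D.contDiffAt_localCovector x)
  -- The factor of `N` in `Data.abs_diff_normSq_le`, with the tangent vector estimated through the
  -- coordinate norm so that the bound is continuous in `y`.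
  refine ⟨fun y => 2 * √(localForm D.γ x y (X y) (X y)) * √‖localForm D.γ x y‖
    + 2 * ‖localCovector D.s x y‖, ?_, ?_⟩
  · have h1 := (contDiffAt_localForm D.γ x).continuousAt
    have h2 := (D.contDiffAt_localCovector x).continuousAt
    have h3 := hX.continuousAt
    exact ((((h1.clm_apply h3).clm_apply h3).sqrt.const_mul 2).mul (continuousAt_sqrt_norm h1)).add
      (h2.norm.const_mul 2)
  · filter_upwards [extChartAt_target_mem_nhds (I := 𝓡 d) x] with y hy
    have hd : MDifferentiableAt (𝓡 d) 𝓘(ℝ, ℝ) (normSq D.γ f) ((extChartAt (𝓡 d) x).symm y) :=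
      hN.mdifferentiable (by simp) _
    refine ⟨mdifferentiableAt_iff_differentiableAt.1
      (hd.comp y (mdifferentiableAt_extChartAt_symm (𝓡 d) hy)), ?_⟩
    have hn : 0 ≤ normSq D.γ f ((extChartAt (𝓡 d) x).symm y) := normSq_nonneg _ _ _
    refine ContinuousLinearMap.opNorm_le_bound _ (by positivity) fun w => ?_
    rw [fderiv_comp_symm (𝓡 d) hy hd, Real.norm_eq_abs, Real.norm_of_nonneg hn]
    refine (D.abs_diff_normSq_le hf (h _) _).trans ?_
    have e2 : |D.s ((extChartAt (𝓡 d) x).symm y) (ofComponents (𝓡 d) x y w)|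
        ≤ ‖localCovector D.s x y‖ * ‖w‖ := (localCovector D.s x y).le_opNorm w
    have e3 : D.γ.form ((extChartAt (𝓡 d) x).symm y)
        (sharp D.γ _ (D.s ((extChartAt (𝓡 d) x).symm y)))
        (sharp D.γ _ (D.s ((extChartAt (𝓡 d) x).symm y))) = localForm D.γ x y (X y) (X y) := by
      rw [localForm_apply, localMetric]
      simp only [X]
      rw [ofComponents_localField (𝓡 d) hy]
    have e4 : √(D.γ.form ((extChartAt (𝓡 d) x).symm y) (ofComponents (𝓡 d) x y w)
        (ofComponents (𝓡 d) x y w)) ≤ √‖localForm D.γ x y‖ * ‖w‖ := sqrt_bilin_le (localForm D.γ x y) w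
    rw [e3]
    calc _ ≤ (2 * √(localForm D.γ x y (X y) (X y)) * (√‖localForm D.γ x y‖ * ‖w‖)
          + 2 * (‖localCovector D.s x y‖ * ‖w‖)) * normSq D.γ f ((extChartAt (𝓡 d) x).symm y) := by
          gcongr
      _ = _ := by ring

end UniqueContinuation

/-! ### Equations for `p = Δf/N` and `r = 2h/N`; multiples of the gradient -/

section Potentials

variable {d : ℕ} {S : Type*} [TopologicalSpace S] [ChartedSpace (EuclideanSpace ℝ (Fin d)) S]

theorem localField_smul (k : S → ℝ) (X : Π x : S, TangentSpace (𝓡 d) x) (x : S) :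
    localField (𝓡 d) (fun q => k q • X q) x = fun y => localFun k x y • localField (𝓡 d) X x y := by
  funext y
  exact map_smul (mfderiv (𝓡 d) 𝓘(ℝ, EuclideanSpace ℝ (Fin d)) (extChartAt (𝓡 d) x)
    ((extChartAt (𝓡 d) x).symm y)) (k ((extChartAt (𝓡 d) x).symm y))
      (X ((extChartAt (𝓡 d) x).symm y))

variable [IsManifold (𝓡 d) ∞ S] (D : Data d S) {f : S → ℝ}

/-- Contracting the equation of `Data.mixedForm_eq` with `grad f` determines `dp(grad f) = 2h - p²
N`; substituting this back determines `dp`. -/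
theorem Data.mixedEq_iff (hf : ContMDiff (𝓡 d) 𝓘(ℝ, ℝ) ∞ f) {p : S → ℝ}
    (hp : ContMDiff (𝓡 d) 𝓘(ℝ, ℝ) ∞ p) (hN : ∀ x, normSq D.γ f x ≠ 0)
    (hH : ∀ x, D.HessianEq f x) (hΦ : ∀ x, laplacian D.γ f x = p x * normSq D.γ f x) (x : S) :
    D.MixedEq f x ↔ diff (𝓡 d) p x
      = (2 * D.h x / normSq D.γ f x - p x ^ 2) • diff (𝓡 d) f x := by
  have hG : diff (𝓡 d) f x (grad D.γ f x) = normSq D.γ f x := (normSq_eq_diff D.γ f x).symm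
  have hNx := hN x
  have key := D.mixedForm_eq hf hp hN hH hΦ x
  constructor
  · intro h
    have h1 : ∀ w : TangentSpace (𝓡 d) x,
        (D.h x - 1 / 2 * p x ^ 2 * normSq D.γ f x + diff (𝓡 d) p x (grad D.γ f x))
          * diff (𝓡 d) f x w - 3 / 2 * normSq D.γ f x * diff (𝓡 d) p x w = 0 := fun w =>
      (key w).symm.trans (h w)
    have h2 := h1 (grad D.γ f x)
    rw [hG] at h2
    have h3 : diff (𝓡 d) p x (grad D.γ f x) = 2 * D.h x - p x ^ 2 * normSq D.γ f x := by
      refine mul_left_cancel₀ hNx ?_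
      linear_combination (-2 : ℝ) * h2
    refine ContinuousLinearMap.ext fun w => ?_
    have h4 := h1 w
    rw [h3] at h4
    simp only [smul_apply, smul_eq_mul]
    refine mul_left_cancel₀ hNx ?_
    field_simp
    linear_combination (-2 / 3 : ℝ) * h4
  · intro h w
    have h' : ∀ w : TangentSpace (𝓡 d) x, diff (𝓡 d) p x w
        = (2 * D.h x / normSq D.γ f x - p x ^ 2) * diff (𝓡 d) f x w := fun w => by rw [h]; rfl
    have h'' : diff (𝓡 d) p x w = _ := h' w
    rw [key, h'', h' (grad D.γ f x), hG]
    field_simp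
    ring

/-- Under the Hessian equation `dN(grad f) = 2 N Δf`, which turns the derivative of `h = ½ N r` into
that of `r`. -/
theorem Data.diff_h_grad_iff (hf : ContMDiff (𝓡 d) 𝓘(ℝ, ℝ) ∞ f) {r : S → ℝ}
    (hr : ContMDiff (𝓡 d) 𝓘(ℝ, ℝ) ∞ r) {x : S} (hN : normSq D.γ f x ≠ 0)
    (hH : D.HessianEq f x) (hh : ∀ x, D.h x = 1 / 2 * normSq D.γ f x * r x) :
    diff (𝓡 d) D.h x (grad D.γ f x) = laplacian D.γ f x * D.h x ↔
      diff (𝓡 d) r x (grad D.γ f x) = -(laplacian D.γ f x * r x) := by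
  have hNs := contMDiff_normSq D.γ hf
  have h1 : D.h = fun x => (1 / 2 * normSq D.γ f x) * r x := funext hh
  have hk : ContMDiff (𝓡 d) 𝓘(ℝ, ℝ) ∞ (fun x => 1 / 2 * normSq D.γ f x) := contMDiff_const.mul hNs
  have h0 := diff_mul (a := fun _ => (1 / 2 : ℝ)) contMDiff_const hNs x (grad D.γ f x)
  have h0' : diff (𝓡 d) (fun _ : S => (1 / 2 : ℝ)) x = 0 := mfderiv_const
  rw [h0', zero_apply, mul_zero, add_zero] at h0
  have h2 : diff (𝓡 d) D.h x (grad D.γ f x)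
      = 1 / 2 * normSq D.γ f x * diff (𝓡 d) r x (grad D.γ f x)
        + r x * (1 / 2 * diff (𝓡 d) (normSq D.γ f) x (grad D.γ f x)) := by
    rw [h1, diff_mul hk hr, h0]
  have h3 : diff (𝓡 d) (normSq D.γ f) x (grad D.γ f x) = _ :=
    D.diff_normSq_of_hessianEq hf hH (grad D.γ f x)
  have h4 := D.laplacian_of_hessianEq hH
  rw [← normSq_eq_diff] at h3
  rw [h2, h3, hh]
  constructor
  · intro h
    refine mul_left_cancel₀ hN ?_
    linear_combination 2 * h + normSq D.γ f x * r x * h4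
  · intro h
    rw [h]
    linear_combination (-1 / 2 : ℝ) * normSq D.γ f x * r x * h4

/-- If `dp = c df` then `dc ∧ df = 0`. -/
theorem diff_mul_diff_comm (hf : ContMDiff (𝓡 d) 𝓘(ℝ, ℝ) ∞ f) {p c : S → ℝ}
    (hp : ContMDiff (𝓡 d) 𝓘(ℝ, ℝ) ∞ p) (hc : ContMDiff (𝓡 d) 𝓘(ℝ, ℝ) ∞ c)
    (h : ∀ x, diff (𝓡 d) p x = c x • diff (𝓡 d) f x) (x : S) (v w : TangentSpace (𝓡 d) x) :
    diff (𝓡 d) c x v * diff (𝓡 d) f x w = diff (𝓡 d) c x w * diff (𝓡 d) f x v := by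
  have h1 : ∀ᶠ z in 𝓝 (extChartAt (𝓡 d) x x),
      fderiv ℝ (localFun p x) z = localFun c x z • fderiv ℝ (localFun f x) z := by
    filter_upwards [eventually_localCovector_diff hp x, eventually_localCovector_diff hf x]
      with y hy1 hy2
    rw [← hy1, ← hy2]
    ext w
    simp only [localCovector_apply, localOneForm, h]
    rfl
  have h2 := fderiv_mul_comm_of_eventuallyEq (contDiffAt_localFun hp.contMDiffAt)
    (contDiffAt_localFun hf.contMDiffAt) (differentiableAt_localFun hc x) h1 v w
  have e1 : ∀ v, diff (𝓡 d) c x v = _ := diff_apply hc x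
  have e2 : ∀ v, diff (𝓡 d) f x v = _ := diff_apply hf x
  rw [e1, e1, e2, e2]
  exact h2

/-- `sharp` is a chosen vector, so linearity rests on its uniqueness, which follows from positivity
of `γ`. -/
theorem sharp_smul (γ : RiemMetric d S) (x : S) (c : ℝ) (α : TangentSpace (𝓡 d) x →L[ℝ] ℝ) :
    sharp γ x (c • α) = c • sharp γ x α := by
  by_contra hne
  have h := γ.pos x (sharp γ x (c • α) - c • sharp γ x α) (sub_ne_zero.2 hne)
  have h1 : ∀ Y, γ.form x (sharp γ x (c • α) - c • sharp γ x α) Y = 0 := by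
    intro Y
    have e1 := form_sharp γ x (c • α) Y
    have e2 := form_sharp γ x α Y
    simp only [RiemMetric.form, map_sub, map_smul, sub_apply, smul_apply, smul_eq_mul]
      at e1 e2 ⊢
    rw [e1, e2, sub_self]
  exact h.ne' (h1 _)

theorem lieDerivMetric_smul_grad (γ : RiemMetric d S) (hf : ContMDiff (𝓡 d) 𝓘(ℝ, ℝ) ∞ f)
    {k : S → ℝ} (hk : ContMDiff (𝓡 d) 𝓘(ℝ, ℝ) ∞ k) (x : S) (v w : EuclideanSpace ℝ (Fin d)) :
    lieDerivMetric (𝓡 d) γ.form (fun q => k q • grad γ f q) x v w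
      = 2 * k x * hessian γ f x v w
        + (diff (𝓡 d) k x v * diff (𝓡 d) f x w + diff (𝓡 d) k x w * diff (𝓡 d) f x v) := by
  have hs : ∀ᶠ z in 𝓝 (extChartAt (𝓡 d) x x), ∀ v w, localForm γ x z v w = localForm γ x z w v :=
    Filter.Eventually.of_forall fun z v w => localForm_symm γ x z v w
  have hG := eventually_localForm_grad γ hf x
  rw [lieDerivMetric_eq_lieForm, localField_smul, lieForm_smul (differentiableAt_localFun hk x)
    (differentiableAt_localField_grad γ hf x) hs.self_of_nhds hG.self_of_nhds,
    lieForm_grad hs hG (differentiableAt_localForm γ x) (differentiableAt_localField_grad γ hf x)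
      (contDiffAt_localFun hf.contMDiffAt), ← hessian_eq_hessForm γ x _ _ hf, localFun_self,
    ← diff_apply hf, ← diff_apply hf, ← diff_apply hk, ← diff_apply hk]
  ring

theorem contMDiff_smul_grad (γ : RiemMetric d S) (hf : ContMDiff (𝓡 d) 𝓘(ℝ, ℝ) ∞ f)
    {k : S → ℝ} (hk : ContMDiff (𝓡 d) 𝓘(ℝ, ℝ) ∞ k) :
    ContMDiff (𝓡 d) (𝓡 d).tangent ∞
      (fun q => (⟨q, k q • grad γ f q⟩ : TangentBundle (𝓡 d) S)) := by
  intro x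
  rw [contMDiffAt_iff_contDiffAt_localField, localField_smul]
  exact (contDiffAt_localFun hk.contMDiffAt).smul (contDiffAt_localField_grad γ hf x)

/-- `d(k df) = dk ∧ df`, and its wedge product with `k df` contains `df` twice. -/
theorem isHypersurfaceOrthogonal_smul_diff (hf : ContMDiff (𝓡 d) 𝓘(ℝ, ℝ) ∞ f)
    {k : S → ℝ} (hk : ContMDiff (𝓡 d) 𝓘(ℝ, ℝ) ∞ k) :
    IsHypersurfaceOrthogonal (𝓡 d) (fun x => k x • diff (𝓡 d) f x) := by
  intro x
  have h1 : localCovector (fun x => k x • diff (𝓡 d) f x) x =ᶠ[𝓝 (extChartAt (𝓡 d) x x)]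
      fun y => localFun k x y • fderiv ℝ (localFun f x) y := by
    filter_upwards [eventually_localCovector_diff hf x] with y hy
    rw [← hy]; rfl
  have hF := contDiffAt_localFun (x := x) hf.contMDiffAt
  have h2 := (differentiableAt_localFun hk x).hasFDerivAt.smul
    hF.differentiableAt_fderiv.hasFDerivAt
  have h3 := h2.congr_of_eventuallyEq h1
  have h4 : ∀ v w : EuclideanSpace ℝ (Fin d),
      extDerivOneForm (𝓡 d) (fun x => k x • diff (𝓡 d) f x) x v w
        = fderiv ℝ (localFun k x) (extChartAt (𝓡 d) x x) v
            * fderiv ℝ (localFun f x) (extChartAt (𝓡 d) x x) w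
          - fderiv ℝ (localFun k x) (extChartAt (𝓡 d) x x) w
            * fderiv ℝ (localFun f x) (extChartAt (𝓡 d) x x) v := by
    intro v w
    rw [extDerivOneForm_eq h3.differentiableAt, h3.fderiv]
    simp only [add_apply, smul_apply, ContinuousLinearMap.smulRight_apply, smul_eq_mul]
    linear_combination localFun k x (extChartAt (𝓡 d) x x) * fderiv_fderiv_comm hF v w
  have h5 : ∀ v, localOneForm (𝓡 d) (fun x => k x • diff (𝓡 d) f x) x (extChartAt (𝓡 d) x x) v
      = localFun k x (extChartAt (𝓡 d) x x)
        * fderiv ℝ (localFun f x) (extChartAt (𝓡 d) x x) v := by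
    intro v
    rw [← localCovector_apply, h1.self_of_nhds]; rfl
  intro a b c
  rw [h4, h4, h4, h5, h5, h5]
  ring

theorem Data.varsigma_sharp (Q : ℝ → ℝ) (x : S) :
    sharp D.γ x (D.varsigma Q f x) = (Q (f x) / normSq D.γ f x) • grad D.γ f x :=
  sharp_smul D.γ x _ _

/-- `dk = -2 k s` for `k = Q(f)/N`. -/
theorem Data.diff_div_normSq (hf : ContMDiff (𝓡 d) 𝓘(ℝ, ℝ) ∞ f) {Q P : ℝ → ℝ}
    (hN : ∀ x, normSq D.γ f x ≠ 0)
    (hs : ∀ x, D.s x = (1 / 2 : ℝ) • ((normSq D.γ f x)⁻¹ • diff (𝓡 d) (normSq D.γ f) x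
      - P (f x) • diff (𝓡 d) f x))
    (hk : ContMDiff (𝓡 d) 𝓘(ℝ, ℝ) ∞ (fun x => Q (f x) / normSq D.γ f x)) {x : S}
    (hQ : DifferentiableAt ℝ Q (f x)) (hQP : deriv Q (f x) = Q (f x) * P (f x))
    (v : TangentSpace (𝓡 d) x) :
    diff (𝓡 d) (fun x => Q (f x) / normSq D.γ f x) x v
      = -2 * (Q (f x) / normSq D.γ f x) * D.s x v := by
  -- Differentiates `k N = Q(f)` instead of the quotient; `Q' = QP` then produces the bracket in the
  -- formula for `s`.
  have h1 := diff_mul hk (contMDiff_normSq D.γ hf) x v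
  have h2 : (fun x => Q (f x) / normSq D.γ f x * normSq D.γ f x) = fun x => Q (f x) :=
    funext fun x => div_mul_cancel₀ _ (hN x)
  rw [h2, diff_comp hf x hQ, hQP] at h1
  rw [hs]
  simp only [smul_apply, sub_apply, smul_eq_mul]
  have hNx := hN x
  generalize diff (𝓡 d) (fun x => Q (f x) / normSq D.γ f x) x v = dk at h1 ⊢
  refine mul_left_cancel₀ hNx ?_
  field_simp at h1 ⊢
  linear_combination -h1

end Potentials

/-! ### Quadratic polynomials as solutions of the ODE system -/

section Quadratic

/-- The quadratic polynomial with value `1`, first derivative `a` and second derivative `b` at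
`t₀`. -/
def quadratic (t₀ a b t : ℝ) : ℝ := 1 + a * (t - t₀) + b / 2 * (t - t₀) ^ 2

theorem hasDerivAt_quadratic (t₀ a b t : ℝ) :
    HasDerivAt (quadratic t₀ a b) (a + b * (t - t₀)) t := by
  have h : HasDerivAt (fun t => t - t₀) 1 t := (hasDerivAt_id t).sub_const t₀
  have h1 := ((h.const_mul a).const_add 1).add ((h.pow 2).const_mul (b / 2))
  refine h1.congr_deriv ?_
  simp
  ring

theorem deriv_quadratic (t₀ a b : ℝ) :
    deriv (quadratic t₀ a b) = fun t => a + b * (t - t₀) :=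
  funext fun t => (hasDerivAt_quadratic t₀ a b t).deriv

theorem hasDerivAt_deriv_quadratic (t₀ a b t : ℝ) :
    HasDerivAt (deriv (quadratic t₀ a b)) b t := by
  rw [deriv_quadratic]
  simpa using (((hasDerivAt_id t).sub_const t₀).const_mul b).const_add a

theorem contDiff_quadratic (t₀ a b : ℝ) : ContDiff ℝ ∞ (quadratic t₀ a b) := by
  unfold quadratic; fun_prop

theorem deriv_logDeriv_quadratic {t₀ a b t : ℝ} (h : quadratic t₀ a b t ≠ 0) :
    deriv (logDeriv (quadratic t₀ a b)) t + logDeriv (quadratic t₀ a b) t ^ 2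
      = b / quadratic t₀ a b t := by
  have h1 := ((hasDerivAt_deriv_quadratic t₀ a b t).div (hasDerivAt_quadratic t₀ a b t) h).deriv
  have h2 : deriv (logDeriv (quadratic t₀ a b)) t = _ := h1
  rw [h2, logDeriv_apply, (hasDerivAt_quadratic t₀ a b t).deriv]
  field_simp
  ring

/-- For `P = Q'/Q` one has `P' + P² = Q''/Q = b/Q`, whose derivative is `-P` times itself because
`b` is constant. -/
theorem solvesODE_quadratic (t₀ a b : ℝ) {J : Set ℝ} (hJ : ∀ t ∈ J, quadratic t₀ a b t ≠ 0) :
    SolvesODE (quadratic t₀ a b) (logDeriv (quadratic t₀ a b)) J := by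
  have hQ := contDiff_quadratic t₀ a b
  refine ⟨hQ.contDiffOn, ?_, fun t ht => ?_, fun t ht => ?_⟩
  · have h1 : ContDiff ℝ ∞ (deriv (quadratic t₀ a b)) := by
      rw [deriv_quadratic]; fun_prop
    exact h1.contDiffOn.div hQ.contDiffOn hJ
  · rw [logDeriv_apply, mul_div_cancel₀ _ (hJ t ht)]
  · have h1 : (fun τ => deriv (logDeriv (quadratic t₀ a b)) τ + logDeriv (quadratic t₀ a b) τ ^ 2)
        =ᶠ[𝓝 t] fun τ => b / quadratic t₀ a b τ := by
      filter_upwards [hQ.continuous.continuousAt.eventually_ne (hJ t ht)] with τ hτ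
      exact deriv_logDeriv_quadratic hτ
    have h2 := ((hasDerivAt_const t b).div (hasDerivAt_quadratic t₀ a b t) (hJ t ht)).deriv
    have h3 : deriv (fun τ => b / quadratic t₀ a b τ) t = _ := h2
    rw [h1.deriv_eq, h3, deriv_logDeriv_quadratic (hJ t ht), logDeriv_apply,
      (hasDerivAt_quadratic t₀ a b t).deriv]
    have := hJ t ht
    field_simp
    ring

end Quadratic

/-! ### From the Killing equations to the potentials `Q` and `P` -/

section Main

variable {d : ℕ} {S : Type*} [TopologicalSpace S] [ChartedSpace (EuclideanSpace ℝ (Fin d)) S]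
  [IsManifold (𝓡 d) ∞ S]

/-- Unique continuation for a homogeneous linear system along `f`. -/
theorem eq_zero_of_diff_eq_mul_diff [PreconnectedSpace S] {f a b c₁ c₂ c₃ c₄ : S → ℝ}
    (hf : ContMDiff (𝓡 d) 𝓘(ℝ, ℝ) ∞ f) (ha : ContMDiff (𝓡 d) 𝓘(ℝ, ℝ) ∞ a)
    (hb : ContMDiff (𝓡 d) 𝓘(ℝ, ℝ) ∞ b) (h₁ : Continuous c₁) (h₂ : Continuous c₂)
    (h₃ : Continuous c₃) (h₄ : Continuous c₄)
    (hda : ∀ x, diff (𝓡 d) a x = (c₁ x * a x + c₂ x * b x) • diff (𝓡 d) f x)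
    (hdb : ∀ x, diff (𝓡 d) b x = (c₃ x * a x + c₄ x * b x) • diff (𝓡 d) f x)
    {x₀ : S} (ha₀ : a x₀ = 0) (hb₀ : b x₀ = 0) (x : S) : a x = 0 ∧ b x = 0 := by
  have key := eq_zero_of_norm_fderiv_le (𝓡 d) (α := fun x => (a x, b x))
    (ha.continuous.prodMk hb.continuous) (fun x => ?_) (x₀ := x₀) (by simp [ha₀, hb₀]) x
  · simpa using key
  let C : S → ℝ := fun x => |c₁ x| + |c₂ x| + |c₃ x| + |c₄ x|
  have hC : Continuous C := ((h₁.abs.add h₂.abs).add h₃.abs).add h₄.abs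
  -- The derivative of `(a, b)` is a matrix with entries `c₁, …, c₄` applied to `(a, b)`, times
  -- `df`; `C` dominates the matrix.
  refine ⟨fun y => C ((extChartAt (𝓡 d) x).symm y) * ‖fderiv ℝ (localFun f x) y‖, ?_, ?_⟩
  · have e1 : ContinuousAt (fun y => C ((extChartAt (𝓡 d) x).symm y)) (extChartAt (𝓡 d) x x) :=
      hC.continuousAt.comp (continuousAt_extChartAt_symm x)
    exact e1.mul (contDiffAt_localFun hf.contMDiffAt).differentiableAt_fderiv.continuousAt.norm
  · filter_upwards [extChartAt_target_mem_nhds (I := 𝓡 d) x] with y hy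
    set q := (extChartAt (𝓡 d) x).symm y
    have hd : ∀ {k : S → ℝ}, ContMDiff (𝓡 d) 𝓘(ℝ, ℝ) ∞ k →
        DifferentiableAt ℝ (localFun k x) y := fun hk =>
      mdifferentiableAt_iff_differentiableAt.1 ((hk.mdifferentiable (by simp) q).comp y
        (mdifferentiableAt_extChartAt_symm (𝓡 d) hy))
    have hsmul : ∀ {k : S → ℝ} {e : ℝ}, ContMDiff (𝓡 d) 𝓘(ℝ, ℝ) ∞ k →
        diff (𝓡 d) k q = e • diff (𝓡 d) f q →
        fderiv ℝ (localFun k x) y = e • fderiv ℝ (localFun f x) y := by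
      intro k e hk hke
      rw [← localCovector_diff hk hy, ← localCovector_diff hf hy]
      ext w
      exact congrArg (fun l : TangentSpace (𝓡 d) q →L[ℝ] ℝ => l (ofComponents (𝓡 d) x y w)) hke
    have hab : HasFDerivAt (fun z => (localFun a x z, localFun b x z)) _ y :=
      (hd ha).hasFDerivAt.prodMk (hd hb).hasFDerivAt
    refine ⟨hab.differentiableAt, ?_⟩
    have e1 : |a q| ≤ ‖(a q, b q)‖ := norm_fst_le (a q, b q)
    have e2 : |b q| ≤ ‖(a q, b q)‖ := norm_snd_le (a q, b q)
    have hn := norm_nonneg (a q, b q)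
    have e3 : ∀ s t : ℝ, |s| + |t| ≤ C q → ‖s * a q + t * b q‖ ≤ C q * ‖(a q, b q)‖ := by
      intro s t hst
      calc ‖s * a q + t * b q‖ ≤ |s| * |a q| + |t| * |b q| := by
            rw [Real.norm_eq_abs, ← abs_mul, ← abs_mul]; exact abs_add_le _ _
        _ ≤ |s| * ‖(a q, b q)‖ + |t| * ‖(a q, b q)‖ := by gcongr
        _ = (|s| + |t|) * ‖(a q, b q)‖ := by ring
        _ ≤ _ := by gcongr
    have f1 := abs_nonneg (c₁ q)
    have f2 := abs_nonneg (c₂ q)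
    have f3 := abs_nonneg (c₃ q)
    have f4 := abs_nonneg (c₄ q)
    have e4 := e3 (c₁ q) (c₂ q) (by simp only [C]; linarith)
    have e5 := e3 (c₃ q) (c₄ q) (by simp only [C]; linarith)
    have hfd : fderiv ℝ (fun z => (a ((extChartAt (𝓡 d) x).symm z),
        b ((extChartAt (𝓡 d) x).symm z))) y = _ := hab.fderiv
    rw [hfd, hsmul ha (hda q), hsmul hb (hdb q)]
    refine ContinuousLinearMap.opNorm_le_bound _ (by positivity) fun w => ?_
    have e6 := (fderiv ℝ (localFun f x) y).le_opNorm w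
    have e7 : ∀ s : ℝ, ‖s‖ ≤ C q * ‖(a q, b q)‖ → ‖s * fderiv ℝ (localFun f x) y w‖
        ≤ C q * ‖fderiv ℝ (localFun f x) y‖ * ‖(a q, b q)‖ * ‖w‖ := by
      intro s hs
      rw [norm_mul]
      calc ‖s‖ * ‖fderiv ℝ (localFun f x) y w‖
          ≤ (C q * ‖(a q, b q)‖) * (‖fderiv ℝ (localFun f x) y‖ * ‖w‖) := by gcongr
        _ = _ := by ring
    exact max_le (e7 _ e4) (e7 _ e5)

variable (D : Data d S) {f : S → ℝ}

/-- A function without critical point at `x` is open there. Thus smoothness of `Q` and `P` on `range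
f` is smoothness at its points, and `deriv` there depends only on values in the range. -/
theorem range_mem_nhds_of_diff_ne_zero (hf : ContMDiff (𝓡 d) 𝓘(ℝ, ℝ) ∞ f) {x : S}
    (hx : diff (𝓡 d) f x ≠ 0) : range f ∈ 𝓝 (f x) := by
  have h1 : HasStrictFDerivAt (localFun f x) (fderiv ℝ (localFun f x) (extChartAt (𝓡 d) x x))
      (extChartAt (𝓡 d) x x) :=
    (contDiffAt_localFun hf.contMDiffAt).hasStrictFDerivAt (by simp)
  have h2 : fderiv ℝ (localFun f x) (extChartAt (𝓡 d) x x) ≠ 0 := by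
    intro h
    apply hx
    refine ContinuousLinearMap.ext fun v => ?_
    refine (diff_apply hf x v).trans ?_
    rw [h]; rfl
  have h3 := h1.map_nhds_eq_of_surj (LinearMap.range_eq_top.2
    (LinearMap.surjective (fun h => h2 (ContinuousLinearMap.coe_injective h))))
  rw [localFun_self] at h3
  rw [← h3, Filter.mem_map]
  exact Filter.univ_mem' fun y => mem_range_self _

/-- Because `dk = -2 k s` for `k = Q(f)/N`, the Killing operator on `ς` is `2k` times the defect in
the Hessian equation. -/
theorem Data.lieDerivMetric_sharp_varsigma (hf : ContMDiff (𝓡 d) 𝓘(ℝ, ℝ) ∞ f) {Q P : ℝ → ℝ}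
    (hN : ∀ x, normSq D.γ f x ≠ 0)
    (hs : ∀ x, D.s x = (1 / 2 : ℝ) • ((normSq D.γ f x)⁻¹ • diff (𝓡 d) (normSq D.γ f) x
      - P (f x) • diff (𝓡 d) f x))
    (hk : ContMDiff (𝓡 d) 𝓘(ℝ, ℝ) ∞ (fun x => Q (f x) / normSq D.γ f x)) {x : S}
    (hQ : DifferentiableAt ℝ Q (f x)) (hQP : deriv Q (f x) = Q (f x) * P (f x))
    (v w : EuclideanSpace ℝ (Fin d)) :
    lieDerivMetric (𝓡 d) D.γ.form (fun x => sharp D.γ x (D.varsigma Q f x)) x v w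
      = 2 * (Q (f x) / normSq D.γ f x) * (hessian D.γ f x v w
        - (diff (𝓡 d) f x v * D.s x w + diff (𝓡 d) f x w * D.s x v)) := by
  rw [funext (D.varsigma_sharp Q), lieDerivMetric_smul_grad D.γ hf hk]
  have h1 : diff (𝓡 d) (fun x => Q (f x) / normSq D.γ f x) x v = _ :=
    D.diff_div_normSq hf hN hs hk hQ hQP v
  have h2 : diff (𝓡 d) (fun x => Q (f x) / normSq D.γ f x) x w = _ :=
    D.diff_div_normSq hf hN hs hk hQ hQP w
  linear_combination diff (𝓡 d) f x w * h1 + diff (𝓡 d) f x v * h2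

/-- The system `dp = (r - p²) df`, `dr = -p r df` is linearized by a quadratic `Q` with `p = Q'/Q`
and `r = Q''/Q`. Comparing along `f` on the connected manifold avoids any assumption on the level
sets. -/
theorem Data.exists_potentials [ConnectedSpace S] (hf : ContMDiff (𝓡 d) 𝓘(ℝ, ℝ) ∞ f)
    (hdf : ∀ x, diff (𝓡 d) f x ≠ 0)
    (hΦ : ContMDiff (𝓡 d) 𝓘(ℝ, ℝ) ∞ (laplacian D.γ f))
    (h : ∀ x, D.HessianEq f x ∧ D.MixedEq f x ∧
      diff (𝓡 d) D.h x (grad D.γ f x) = laplacian D.γ f x * D.h x) :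
    ∃ Q P : ℝ → ℝ, D.CondKilling f Q P ∧ D.CondTorsion f P := by
  have hN : ∀ x, normSq D.γ f x ≠ 0 := fun x h0 => hdf x ((normSq_eq_zero_iff D.γ).1 h0)
  have hNs := contMDiff_normSq D.γ hf
  have hH : ∀ x, D.HessianEq f x := fun x => (h x).1
  let p : S → ℝ := fun x => laplacian D.γ f x / normSq D.γ f x
  let r : S → ℝ := fun x => 2 * D.h x / normSq D.γ f x
  have hp : ContMDiff (𝓡 d) 𝓘(ℝ, ℝ) ∞ p := hΦ.div₀ hNs hN
  have hr : ContMDiff (𝓡 d) 𝓘(ℝ, ℝ) ∞ r := (contMDiff_const.mul D.smooth_h).div₀ hNs hN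
  have hΦp : ∀ x, laplacian D.γ f x = p x * normSq D.γ f x := fun x =>
    (div_mul_cancel₀ _ (hN x)).symm
  have hhr : ∀ x, D.h x = 1 / 2 * normSq D.γ f x * r x := by
    intro x
    have := hN x
    simp only [r]
    field_simp
  have hdp : ∀ x, diff (𝓡 d) p x = (r x - p x ^ 2) • diff (𝓡 d) f x := fun x =>
    (D.mixedEq_iff hf hp hN hH hΦp x).1 (h x).2.1
  have hc : ContMDiff (𝓡 d) 𝓘(ℝ, ℝ) ∞ (fun x => r x - p x ^ 2) := hr.sub (hp.pow 2)
  have hdp2 : ∀ x v, diff (𝓡 d) (fun x => r x - p x ^ 2) x v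
      = diff (𝓡 d) r x v - 2 * p x * diff (𝓡 d) p x v := by
    intro x v
    have e1 := ((differentiableAt_localFun hr x).hasFDerivAt.sub
      ((differentiableAt_localFun hp x).hasFDerivAt.pow 2)).fderiv
    have e2 := diff_apply hc x v
    have e3 : diff (𝓡 d) r x v = _ := diff_apply hr x v
    have e4 : diff (𝓡 d) p x v = _ := diff_apply hp x v
    rw [e3, e4]
    refine e2.trans ((congrArg (fun l : EuclideanSpace ℝ (Fin d) →L[ℝ] ℝ => l v) e1).trans ?_)
    simp [localFun]
    rfl
  have hdr : ∀ x, diff (𝓡 d) r x = (-(p x * r x)) • diff (𝓡 d) f x := by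
    intro x
    have e1 := (D.diff_h_grad_iff hf hr (hN x) (hH x) hhr).1 (h x).2.2
    refine ContinuousLinearMap.ext fun v => mul_right_cancel₀ (hN x) ?_
    -- Only `dr(grad f)` is known so far; `d(r - p²) ∧ df = 0` shows that `dr` is a multiple of
    -- `df`.
    have e2 := diff_mul_diff_comm hf hp hc hdp x v (grad D.γ f x)
    rw [hdp2, hdp2, ← normSq_eq_diff, hdp, e1, hΦp] at e2
    simp only [smul_apply, smul_eq_mul] at e2 ⊢
    rw [← normSq_eq_diff] at e2
    linear_combination e2
  obtain ⟨x₀⟩ : Nonempty S := inferInstance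
  let Q := quadratic (f x₀) (p x₀) (r x₀)
  have hQ : ContDiff ℝ ∞ Q := contDiff_quadratic _ _ _
  have hQ' : ContDiff ℝ ∞ (deriv Q) := by
    simp only [Q, deriv_quadratic]; fun_prop
  have hQf : ContMDiff (𝓡 d) 𝓘(ℝ, ℝ) ∞ (fun x => Q (f x)) := hQ.contMDiff.comp hf
  have hQf' : ContMDiff (𝓡 d) 𝓘(ℝ, ℝ) ∞ (fun x => deriv Q (f x)) := hQ'.contMDiff.comp hf
  have hdA : ∀ x v, diff (𝓡 d) (fun x => Q (f x)) x v = deriv Q (f x) * diff (𝓡 d) f x v :=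
    fun x v => diff_comp hf x (hQ.differentiable (by simp) _) v
  have hdB : ∀ x v, diff (𝓡 d) (fun x => deriv Q (f x)) x v = r x₀ * diff (𝓡 d) f x v := by
    intro x v
    rw [diff_comp hf x (hQ'.differentiable (by simp) _) v,
      (hasDerivAt_deriv_quadratic (f x₀) (p x₀) (r x₀) (f x)).deriv]
  have hsub : ∀ {a b : S → ℝ}, ContMDiff (𝓡 d) 𝓘(ℝ, ℝ) ∞ a → ContMDiff (𝓡 d) 𝓘(ℝ, ℝ) ∞ b →
      ∀ x v, diff (𝓡 d) (fun x => a x - b x) x v = diff (𝓡 d) a x v - diff (𝓡 d) b x v := by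
    intro a b ha hb x v
    have e1 := ((ha.mdifferentiable (by simp) x).hasMFDerivAt.sub
      (hb.mdifferentiable (by simp) x).hasMFDerivAt).mfderiv
    exact congrArg (fun l : EuclideanSpace ℝ (Fin d) →L[ℝ] ℝ => l v) e1
  have hpQ : ContMDiff (𝓡 d) 𝓘(ℝ, ℝ) ∞ (fun x => p x * Q (f x)) := hp.mul hQf
  have hrQ : ContMDiff (𝓡 d) 𝓘(ℝ, ℝ) ∞ (fun x => r x * Q (f x)) := hr.mul hQf
  -- With `a = Q'(f) - p Q(f)` and `b = Q'' - r Q(f)` one finds `da = (-p a + b) df` and `db = -r a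
  -- df`; both vanish at `x₀` by the choice of `Q`.
  have hzero := fun x => eq_zero_of_diff_eq_mul_diff (x₀ := x₀) (x := x) hf
    (a := fun x => deriv Q (f x) - p x * Q (f x)) (b := fun x => r x₀ - r x * Q (f x))
    (c₁ := fun x => -p x) (c₂ := fun _ => 1) (c₃ := fun x => -r x) (c₄ := fun _ => 0)
    (hQf'.sub hpQ) (contMDiff_const.sub hrQ) hp.continuous.neg
    continuous_const hr.continuous.neg continuous_const
    (fun x => by
      refine ContinuousLinearMap.ext fun v => ?_
      rw [hsub hQf' hpQ, hdB, diff_mul hp hQf, hdA, hdp]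
      simp only [smul_apply, smul_eq_mul]
      ring)
    (fun x => by
      refine ContinuousLinearMap.ext fun v => ?_
      have h0 : diff (𝓡 d) (fun _ : S => r x₀) x = 0 := mfderiv_const
      rw [hsub (a := fun _ => r x₀) contMDiff_const hrQ, h0, diff_mul hr hQf, hdA, hdr]
      simp only [smul_apply, smul_eq_mul, zero_apply]
      ring)
    (by simp [Q, deriv_quadratic, quadratic]) (by simp [Q, quadratic])
  have hQp : ∀ x, deriv Q (f x) = p x * Q (f x) := fun x => sub_eq_zero.1 (hzero x).1
  have hQr : ∀ x, r x₀ = r x * Q (f x) := fun x => sub_eq_zero.1 (hzero x).2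
  -- At a zero the two identities force `r x₀ = 0`, so `Q'` is constant, and then `p x₀ = 0`; but
  -- then `Q` is the constant `1`.
  have hQ0 : ∀ x, Q (f x) ≠ 0 := by
    intro x hx
    have e1 := hQr x
    have e2 := hQp x
    rw [hx, mul_zero] at e1 e2
    have e3 : p x₀ = 0 := by
      simp only [Q, deriv_quadratic] at e2
      rw [e1] at e2
      linarith
    simp [Q, quadratic, e1, e3] at hx
  let P := logDeriv Q
  have hPp : ∀ x, P (f x) = p x := fun x => by
    simp only [P, logDeriv_apply, hQp, mul_div_cancel_right₀ _ (hQ0 x)]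
  have hPr : ∀ x, deriv P (f x) + P (f x) ^ 2 = r x := by
    intro x
    refine (deriv_logDeriv_quadratic (hQ0 x)).trans ?_
    rw [div_eq_iff (hQ0 x)]
    exact hQr x
  have hs : ∀ x, D.s x = (1 / 2 : ℝ) • ((normSq D.γ f x)⁻¹ • diff (𝓡 d) (normSq D.γ f) x
      - P (f x) • diff (𝓡 d) f x) := by
    intro x
    rw [hPp]
    exact D.s_eq_of_hessianEq hf (hH x) (hN x)
  have hode : SolvesODE Q P (range f) :=
    solvesODE_quadratic _ _ _ (by rintro _ ⟨x, rfl⟩; exact hQ0 x)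
  have hk : ContMDiff (𝓡 d) 𝓘(ℝ, ℝ) ∞ (fun x => Q (f x) / normSq D.γ f x) := hQf.div₀ hNs hN
  refine ⟨Q, P, ⟨hdf, hode, ⟨f x₀, mem_range_self _, hQ0 x₀⟩, ?_,
    isHypersurfaceOrthogonal_smul_diff hf hk⟩, hs, fun x => by rw [hPr]; exact hhr x⟩
  refine ⟨?_, fun x _ v w => ?_⟩
  · rw [funext (D.varsigma_sharp Q)]
    exact (contMDiff_smul_grad D.γ hf hk).contMDiffOn
  · rw [D.lieDerivMetric_sharp_varsigma hf hN hs hk (hQ.differentiable (by simp) (f x))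
      (hode.2.2.1 _ (mem_range_self x)), hH x]
    ring

end Main

/-! ### From the potentials back to the Killing equations; closedness of `s` -/

section Converse

variable {d : ℕ} {S : Type*} [TopologicalSpace S] [ChartedSpace (EuclideanSpace ℝ (Fin d)) S]

theorem diff_comp_eq_smul {f : S → ℝ} (hf : ContMDiff (𝓡 d) 𝓘(ℝ, ℝ) ∞ f) {P : ℝ → ℝ} {x : S}
    (hP : DifferentiableAt ℝ P (f x)) :
    diff (𝓡 d) (fun y => P (f y)) x = deriv P (f x) • diff (𝓡 d) f x :=
  ContinuousLinearMap.ext fun v => diff_comp hf x hP v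

variable [IsManifold (𝓡 d) ∞ S] (D : Data d S) {f : S → ℝ}

/-- Since `Q(f)` has no zeros, the Killing equation of `ς` gives the Hessian equation. Its formula
for `s` then identifies `Δf/N` with `P(f)`, and the other two equations become the chain rule and
the ODE for `P`. -/
theorem Data.killing_equations_of_potentials [PreconnectedSpace S]
    (hf : ContMDiff (𝓡 d) 𝓘(ℝ, ℝ) ∞ f) {Q P : ℝ → ℝ} (hK : D.CondKilling f Q P)
    (hT : D.CondTorsion f P) :
    ContMDiff (𝓡 d) 𝓘(ℝ, ℝ) ∞ (laplacian D.γ f) ∧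
      ∀ x, D.HessianEq f x ∧ D.MixedEq f x ∧
        diff (𝓡 d) D.h x (grad D.γ f x) = laplacian D.γ f x * D.h x := by
  obtain ⟨hdf, ⟨hQ, hP, hQP, hPP⟩, ⟨_, ⟨x₁, rfl⟩, hx₁⟩, ⟨-, hL⟩, -⟩ := hK
  obtain ⟨hs, hh⟩ := hT
  have hN : ∀ x, normSq D.γ f x ≠ 0 := fun x h0 => hdf x ((normSq_eq_zero_iff D.γ).1 h0)
  have hNs := contMDiff_normSq D.γ hf
  have hJ : ∀ x, range f ∈ 𝓝 (f x) := fun x => range_mem_nhds_of_diff_ne_zero hf (hdf x)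
  have hQa : ∀ x, ContDiffAt ℝ ∞ Q (f x) := fun x => hQ.contDiffAt (hJ x)
  have hPa : ∀ x, ContDiffAt ℝ ∞ P (f x) := fun x => hP.contDiffAt (hJ x)
  have hQf : ContMDiff (𝓡 d) 𝓘(ℝ, ℝ) ∞ (fun x => Q (f x)) := fun x =>
    (hQa x).contMDiffAt.comp x (hf x)
  have hPf : ContMDiff (𝓡 d) 𝓘(ℝ, ℝ) ∞ (fun x => P (f x)) := fun x =>
    (hPa x).contMDiffAt.comp x (hf x)
  -- A zero of `Q(f)` would propagate over all of `S` through `d(Q(f)) = P(f) Q(f) df`; the second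
  -- unknown of the linear system is taken to be zero.
  have hQ0 : ∀ x, Q (f x) ≠ 0 := by
    intro x hx
    refine hx₁ (eq_zero_of_diff_eq_mul_diff hf (a := fun x => Q (f x)) (b := fun _ => (0 : ℝ))
      (c₁ := fun x => P (f x)) (c₂ := fun _ => 0) (c₃ := fun _ => 0) (c₄ := fun _ => 0) hQf
      contMDiff_const hPf.continuous continuous_const continuous_const continuous_const
      (fun y => ?_) (fun y => ?_) hx rfl x₁).1
    · rw [diff_comp_eq_smul hf ((hQa y).differentiableAt (by simp)), hQP _ (mem_range_self y),
        zero_mul, add_zero, mul_comm]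
    · rw [zero_mul, zero_mul, add_zero, zero_smul]
      exact mfderiv_const
  have hk : ContMDiff (𝓡 d) 𝓘(ℝ, ℝ) ∞ (fun x => Q (f x) / normSq D.γ f x) := hQf.div₀ hNs hN
  have hH : ∀ x, D.HessianEq f x := by
    intro x v w
    have h1 := (D.lieDerivMetric_sharp_varsigma hf hN hs hk ((hQa x).differentiableAt (by simp))
      (hQP _ (mem_range_self x)) v w).symm.trans (hL x (mem_univ x) v w)
    exact sub_eq_zero.1 ((mul_eq_zero.1 h1).resolve_left
      (mul_ne_zero two_ne_zero (div_ne_zero (hQ0 x) (hN x))))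
  have hΦ : ∀ x, laplacian D.γ f x = P (f x) * normSq D.γ f x := by
    intro x
    -- Two expressions for `s` with the same `dN/N` part; as `df ≠ 0`, the coefficients of `df`
    -- agree.
    have h1 := (D.s_eq_of_hessianEq hf (hH x) (hN x)).symm.trans (hs x)
    have h2 := sub_right_injective (smul_right_injective _ (by norm_num : (1 / 2 : ℝ) ≠ 0) h1)
    exact (div_eq_iff (hN x)).1 (smul_left_injective ℝ (hdf x) h2)
  have hr : ∀ x, 2 * D.h x / normSq D.γ f x = deriv P (f x) + P (f x) ^ 2 := by
    intro x
    have := hN x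
    rw [hh]
    field_simp
  have hrs : ContMDiff (𝓡 d) 𝓘(ℝ, ℝ) ∞ (fun x => deriv P (f x) + P (f x) ^ 2) := by
    rw [← funext hr]
    exact (contMDiff_const.mul D.smooth_h).div₀ hNs hN
  refine ⟨by rw [funext hΦ]; exact hPf.mul hNs, fun x => ⟨hH x, ?_, ?_⟩⟩
  · rw [D.mixedEq_iff hf hPf hN hH hΦ, hr, add_sub_cancel_right]
    exact diff_comp_eq_smul hf ((hPa x).differentiableAt (by simp))
  · rw [D.diff_h_grad_iff hf hrs (hN x) (hH x) hh]
    have hP1 : DifferentiableAt ℝ (deriv P) (f x) :=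
      (hPa x).differentiableAt_fderiv.clm_apply (differentiableAt_const 1)
    have h1 := diff_comp hf x (P := fun τ => deriv P τ + P τ ^ 2)
      (hP1.add (((hPa x).differentiableAt (by simp)).pow 2)) (grad D.γ f x)
    rw [h1, ← normSq_eq_diff, hΦ]
    linear_combination normSq D.γ f x * hPP _ (mem_range_self x)

/-- `ds = -½ d(P(f)) ∧ df`, and `d(P(f))` is a multiple of `df`. -/
theorem Data.isClosedOneForm_s (hf : ContMDiff (𝓡 d) 𝓘(ℝ, ℝ) ∞ f) {Q P : ℝ → ℝ}
    (hK : D.CondKilling f Q P) (hT : D.CondTorsion f P) : IsClosedOneForm (𝓡 d) D.s := by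
  obtain ⟨hdf, ⟨-, hP, -⟩, -⟩ := hK
  have hN : ∀ x, normSq D.γ f x ≠ 0 := fun x h0 => hdf x ((normSq_eq_zero_iff D.γ).1 h0)
  have hPa : ∀ x, ContDiffAt ℝ ∞ P (f x) := fun x =>
    hP.contDiffAt (range_mem_nhds_of_diff_ne_zero hf (hdf x))
  have hPf : ContMDiff (𝓡 d) 𝓘(ℝ, ℝ) ∞ (fun x => P (f x)) := fun x =>
    (hPa x).contMDiffAt.comp x (hf x)
  intro x v w
  have hPx := diff_comp hf x ((hPa x).differentiableAt (by simp))
  rw [extDerivOneForm_eq ((D.contDiffAt_localCovector x).differentiableAt (by simp)),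
    D.extDeriv_s hf hPf hN hT.1]
  refine (congrArg₂ (fun a b : ℝ => -(1 / 2) * (a * diff (𝓡 d) f x w - b * diff (𝓡 d) f x v))
    (hPx v) (hPx w)).trans ?_
  ring

end Converse

/-! ### Geometry at `u = 0`: induced metric, null direction, surface gravity -/

section Horizon

variable {d : ℕ} {S : Type*} [TopologicalSpace S] [ChartedSpace (EuclideanSpace ℝ (Fin d)) S]

theorem hasMFDerivAt_uCoord (p : ℝ × ℝ × S) :
    HasMFDerivAt (model d) 𝓘(ℝ, ℝ) (uCoord (S := S)) p
      ((ContinuousLinearMap.fst ℝ ℝ (EuclideanSpace ℝ (Fin d))).comp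
        (ContinuousLinearMap.snd ℝ ℝ (ℝ × EuclideanSpace ℝ (Fin d)))) :=
  HasMFDerivAt.comp p (hasMFDerivAt_fst p.2) (hasMFDerivAt_snd p)

theorem diff_uCoord (p : ℝ × ℝ × S) (X : TangentSpace (model d) p) :
    diff (model d) uCoord p X = uPart X :=
  congrArg (fun l : ℝ × ℝ × EuclideanSpace ℝ (Fin d) →L[ℝ] ℝ => l X)
    (hasMFDerivAt_uCoord (d := d) p).mfderiv

/-- A function of the form `u² F` with `F` differentiable is critical at `u = 0`. -/
theorem diff_sq_mul_eq_zero {F : ℝ × ℝ × S → ℝ} {p : ℝ × ℝ × S} (hp : p.2.1 = 0)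
    (hF : MDifferentiableAt (model d) 𝓘(ℝ, ℝ) F p) (X : TangentSpace (model d) p) :
    diff (model d) (fun q => q.2.1 ^ 2 * F q) p X = 0 := by
  have h := ((hasMFDerivAt_uCoord (d := d) p).mul (hasMFDerivAt_uCoord (d := d) p)).mul
    hF.hasMFDerivAt
  have h1 : (fun q : ℝ × ℝ × S => q.2.1 ^ 2 * F q) = uCoord * uCoord * F :=
    funext fun q => by simp [uCoord, sq]
  rw [h1]
  refine (congrArg (fun l : ℝ × ℝ × EuclideanSpace ℝ (Fin d) →L[ℝ] ℝ => l X) h.mfderiv).trans ?_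
  have h2 : uCoord p = 0 := hp
  simp [h2]
  exact zero_mul _

theorem cutMap_mfderiv {F : S → ℝ} (hF : ContMDiff (𝓡 d) 𝓘(ℝ, ℝ) ∞ F) (x : S)
    (X : TangentSpace (𝓡 d) x) :
    mfderiv (𝓡 d) (model d) (cutMap F) x X
      = mkTangent (cutMap F x) (diff (𝓡 d) F x X) 0 X := by
  have h := (hF.mdifferentiable (by simp) x).hasMFDerivAt.prodMk
    ((hasMFDerivAt_const (I' := 𝓘(ℝ, ℝ)) (0 : ℝ) x).prodMk (hasMFDerivAt_id (I := 𝓡 d) x))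
  exact congrArg (fun l : EuclideanSpace ℝ (Fin d) →L[ℝ] ℝ × ℝ × EuclideanSpace ℝ (Fin d) => l X)
    h.mfderiv

theorem mem_closure_ne_zero_of_diff_ne_zero {f : S → ℝ} (hdf : ∀ x, diff (𝓡 d) f x ≠ 0) (x : S) :
    x ∈ closure {y | f y ≠ 0} := by
  by_contra h
  have h1 : f =ᶠ[𝓝 x] fun _ => (0 : ℝ) := by
    filter_upwards [isClosed_closure.isOpen_compl.mem_nhds h] with y hy
    by_contra hne
    exact hy (subset_closure hne)
  exact hdf x (h1.mfderiv_eq.trans mfderiv_const)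

variable [IsManifold (𝓡 d) ∞ S] (D : Data d S) {f : S → ℝ}

theorem Data.metric_of_u_eq_zero {p : ℝ × ℝ × S} (hp : p.2.1 = 0)
    (X Y : TangentSpace (model d) p) : D.metric p X Y
      = vPart X * uPart Y + vPart Y * uPart X + D.γ.form p.2.2 (sPart X) (sPart Y) := by
  simp [Data.metric, Data.conormal, hp]

theorem Data.cutMetric_eq {F : S → ℝ} (hF : ContMDiff (𝓡 d) 𝓘(ℝ, ℝ) ∞ F) (x : S)
    (X Y : TangentSpace (𝓡 d) x) : D.cutMetric F x X Y = D.γ.form x X Y := by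
  rw [Data.cutMetric, cutMap_mfderiv hF, cutMap_mfderiv hF, D.metric_of_u_eq_zero rfl]
  simp [vPart, uPart, sPart, mkTangent, cutMap]

/-- The factor `u²` makes both `g(ζ,ζ)` and its differential vanish on the horizon, which is why the
surface gravity is zero. -/
theorem Data.metric_zeta (p : ℝ × ℝ × S) : D.metric p (D.zeta f p) (D.zeta f p)
    = p.2.1 ^ 2 * (f p.2.2 * laplacian D.γ f p.2.2
        - 4 * f p.2.2 * D.s p.2.2 (grad D.γ f p.2.2)
        + f p.2.2 ^ 2 * D.h p.2.2 + normSq D.γ f p.2.2) := by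
  have e1 : vPart (D.zeta f p) = f p.2.2 := rfl
  have e2 : uPart (D.zeta f p) = p.2.1 ^ 2 / 2 * laplacian D.γ f p.2.2 := rfl
  have e3 : sPart (D.zeta f p) = -p.2.1 • grad D.γ f p.2.2 := rfl
  simp only [Data.metric, Data.conormal, normSq, e1, e2, e3, RiemMetric.form, map_smul,
    smul_apply, smul_eq_mul]
  ring

theorem Data.isDegenerateKillingGenerator_of_isKillingOn (hf : ContMDiff (𝓡 d) 𝓘(ℝ, ℝ) ∞ f)
    (hdf : ∀ x, diff (𝓡 d) f x ≠ 0) (hΦ : ContMDiff (𝓡 d) 𝓘(ℝ, ℝ) ∞ (laplacian D.γ f))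
    {U : Set (ℝ × ℝ × S)} (hU : IsOpen U) (hK : IsKillingOn (model d) D.metric U (D.zeta f)) :
    IsDegenerateKillingGenerator (model d) D.metric U uCoord (D.zeta f) := by
  have hfp : Continuous fun p : ℝ × ℝ × S => f p.2.2 := hf.continuous.comp (by fun_prop)
  -- On the horizon `ζ = f ∂_v`, so exactly the zeros of `f` have to be removed; they have empty
  -- interior because `df ≠ 0`.
  refine ⟨hK, U ∩ {p | f p.2.2 ≠ 0}, hU.inter (isOpen_ne_fun hfp continuous_const),
    inter_subset_left, ?_, ?_, ?_⟩
  · rintro ⟨v, u, x⟩ ⟨hpU, hu⟩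
    obtain rfl : u = 0 := hu
    have hc : Continuous fun y : S => ((v, 0, y) : ℝ × ℝ × S) := by fun_prop
    have h1 := mem_closure_iff_frequently.1 (mem_closure_ne_zero_of_diff_ne_zero hdf x)
    refine mem_closure_of_frequently_of_tendsto ?_ hc.continuousAt
    exact (h1.and_eventually (hc.continuousAt.preimage_mem_nhds (hU.mem_nhds hpU))).mono
      fun y hy => ⟨⟨hy.2, hy.1⟩, rfl⟩
  · rintro p ⟨⟨-, hfp0⟩, hu⟩
    have hu' : p.2.1 = 0 := hu
    -- The null normal is `∂_v`: at `u = 0` its product with a vector is the `∂_u` component of that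
    -- vector.
    refine ⟨⟨mkTangent p 1 0 0, ?_, ?_, fun X hX => ?_⟩, ?_, ?_, ?_⟩
    · intro h
      exact one_ne_zero (congrArg (fun X => vPart X) h)
    · rw [diff_uCoord]; rfl
    · rw [diff_uCoord] at hX
      rw [D.metric_of_u_eq_zero hu', hX]
      simp [mkTangent, uPart, sPart, RiemMetric.form]
    · intro h
      exact hfp0 (congrArg (fun X => vPart X) h)
    · rw [D.metric_zeta, hu']; ring
    · rw [diff_uCoord]
      change p.2.1 ^ 2 / 2 * laplacian D.γ f p.2.2 = 0
      rw [hu']; ring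
  · rintro p ⟨-, hu⟩ X
    rw [mul_zero, zero_mul, funext fun q => D.metric_zeta (f := f) q]
    refine diff_sq_mul_eq_zero hu ?_ X
    have hsG : ContMDiff (𝓡 d) 𝓘(ℝ, ℝ) ∞ (fun x => D.s x (grad D.γ f x)) :=
      contMDiff_apply_grad D.γ D.contDiffAt_localCovector hf
    have h1 : ContMDiff (𝓡 d) 𝓘(ℝ, ℝ) ∞ (fun x => f x * laplacian D.γ f x
        - 4 * f x * D.s x (grad D.γ f x) + f x ^ 2 * D.h x + normSq D.γ f x) :=
      (((hf.mul hΦ).sub ((contMDiff_const.mul hf).mul hsG)).add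
        ((hf.pow 2).mul D.smooth_h)).add (contMDiff_normSq D.γ hf)
    exact (h1.mdifferentiable (by simp) p.2.2).comp p
      ((hasMFDerivAt_snd (I := 𝓘(ℝ, ℝ)) (I' := 𝓡 d) p.2).comp p
        (hasMFDerivAt_snd (I := 𝓘(ℝ, ℝ)) (I' := 𝓘(ℝ, ℝ).prod (𝓡 d)) p)).mdifferentiableAt

end Horizon

end NHG

end

theorem mainTheorem4 {d : ℕ} {S : Type*} [TopologicalSpace S] [T2Space S]
    [SecondCountableTopology S] [ConnectedSpace S]
    [ChartedSpace (EuclideanSpace ℝ (Fin d)) S] [IsManifold (𝓡 d) ∞ S]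
    (D : NHG.Data d S)
    (U : Set (ℝ × ℝ × S)) (hU : IsOpen U) (hU₀ : ∀ x : S, ∃ v : ℝ, (v, (0 : ℝ), x) ∈ U)
    (f : S → ℝ) (hf : ContMDiff (𝓡 d) 𝓘(ℝ, ℝ) ∞ f) (hf' : ¬ ∃ c : ℝ, ∀ x, f x = c) :
    (NHG.IsDegenerateKillingGenerator (NHG.model d) D.metric U NHG.uCoord (D.zeta f) ↔
      ∃ Q P : ℝ → ℝ, D.CondKilling f Q P ∧ D.CondTorsion f P) ∧
    (NHG.IsDegenerateKillingGenerator (NHG.model d) D.metric U NHG.uCoord (D.zeta f) →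
      NHG.IsClosedOneForm (𝓡 d) D.s) ∧
    (∀ F : S → ℝ, ContMDiff (𝓡 d) 𝓘(ℝ, ℝ) ∞ F →
      ∀ (x : S) (X Y : TangentSpace (𝓡 d) x), D.cutMetric F x X Y = D.γ.form x X Y) := by
  have forward : NHG.IsDegenerateKillingGenerator (NHG.model d) D.metric U NHG.uCoord (D.zeta f) →
      ∃ Q P : ℝ → ℝ, D.CondKilling f Q P ∧ D.CondTorsion f P := by
    rintro ⟨hK, -⟩
    obtain ⟨hΦ, h⟩ := (D.isKillingOn_zeta_iff hf hU hU₀).1 hK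
    exact D.exists_potentials hf
      (D.diff_ne_zero_of_hessianEq hf hf' fun x => (h x).1) hΦ h
  refine ⟨⟨forward, ?_⟩, fun h => ?_, fun F hF => D.cutMetric_eq hF⟩
  · rintro ⟨Q, P, hK, hT⟩
    have h := D.killing_equations_of_potentials hf hK hT
    exact D.isDegenerateKillingGenerator_of_isKillingOn hf hK.1 h.1 hU
      ((D.isKillingOn_zeta_iff hf hU hU₀).2 h)
  · obtain ⟨Q, P, hK, hT⟩ := forward h
    exact D.isClosedOneForm_s hf hK hT
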